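/- Let $\Gamma_{CK}=\langle a,b,c,d\mid [a,b]=[b,c]=[c,d]=1\rangle$, and let $X_{CK}$ be the universal covering of the square complex that has one vertex, four edges labelled $a,b,c,d$, and three squares attached along the relators $aba^{-1}b^{-1}$, $bcb^{-1}c^{-1}$, $cdc^{-1}d^{-1}$; this is a locally finite CAT(0) cube complex. Let $\mathrm{Aut}(X_{CK})$ be the group of its cubical isometries, with the compact-open topology, which makes it a topological group. A halfspace of $X_{CK}$ is a connected component of the complement of a hyperplane, and $\mathrm{Aut}^{+}(X_{CK})$ is the subgroup generated by the elements of $\mathrm{Aut}(X_{CK})$ that fix some halfspace pointwise, with the subspace topology. Then the quotient $\mathrm{Aut}(X_{CK})/\overline{\mathrm{Aut}^{+}(X_{CK})}$ is not compact, while $\mathrm{Aut}^{+}(X_{CK})$ is simple (as an abstract group), non-discrete, totally disconnected and locally compact. -/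

import Mathlib

open Topology

noncomputable section

namespace CrokeKleiner

/-- The four standard generators of the Croke-Kleiner group. -/
inductive Gen : Type
  | a
  | b
  | c
  | d

/-- The word `x y x⁻¹ y⁻¹`. -/
def commWord (x y : Gen) : FreeGroup Gen :=
  FreeGroup.of x * FreeGroup.of y * (FreeGroup.of x)⁻¹ * (FreeGroup.of y)⁻¹

/-- The relators `[a,b]`, `[b,c]`, `[c,d]`. -/
def relators : Set (FreeGroup Gen) :=
  {commWord Gen.a Gen.b, commWord Gen.b Gen.c, commWord Gen.c Gen.d}

/-- The right-angled Artin group `⟨a, b, c, d ∣ [a,b] = [b,c] = [c,d] = 1⟩`. -/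
abbrev Grp : Type := PresentedGroup relators

/-- The image of a generator in the group. -/
def gen (s : Gen) : Grp := PresentedGroup.of s

/-- The pairs of generators that occur in the defining relators, in either order. -/
inductive Linked : Gen → Gen → Prop
  | ab : Linked Gen.a Gen.b
  | ba : Linked Gen.b Gen.a
  | bc : Linked Gen.b Gen.c
  | cb : Linked Gen.c Gen.b
  | cd : Linked Gen.c Gen.d
  | dc : Linked Gen.d Gen.c

/-!
The universal cover `X` of the complex with one vertex, four edges and three squares attached along
the relators: its vertices are the group elements, its edges join `v` to `v s`, and its squares
have corners `v`, `v s`, `v s t`, `v t` with `s`, `t` generators linked by a relator.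
-/

/-- `x` is the generator `s` or its inverse. -/
def IsLetter (s : Gen) (x : Grp) : Prop := x = gen s ∨ x = (gen s)⁻¹

/-- `v` and `w` are the endpoints of an edge of `X`. -/
def IsEdge (v w : Grp) : Prop := ∃ s x, IsLetter s x ∧ w = v * x

/-- `v`, `w`, `z`, `u` are, in this cyclic order, the corners of a square of `X`. As inverse letters
are allowed, each square occurs with every choice of first corner and of direction. -/
def IsSquareCell (v w z u : Grp) : Prop :=
  ∃ s t x y, Linked s t ∧ IsLetter s x ∧ IsLetter t y ∧ w = v * x ∧ z = v * x * y ∧ u = v * y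

/-- The vertex `v` as a point of the geometric realization (a Dirac mass). -/
def dirac (v : Grp) : Grp → ℝ := Set.indicator {v} 1

/-- The point with coordinates `(p, q) ∈ [0,1]²` in the square with corners `v`, `w`, `z`, `u`:
the edge from `v` to `w` is the `p`-axis, the edge from `v` to `u` is the `q`-axis. -/
def squarePoint (v w z u : Grp) (p q : ℝ) : Grp → ℝ :=
  ((1 - p) * (1 - q)) • dirac v + (p * (1 - q)) • dirac w + (p * q) • dirac z
    + ((1 - p) * q) • dirac u

/-- The points of the geometric realization of `X`. Every vertex and every edge of `X` lies in a
square, so the squares cover `X`. -/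
def realization : Set (Grp → ℝ) :=
  {x | ∃ v w z u, IsSquareCell v w z u ∧
    ∃ p ∈ Set.Icc (0 : ℝ) 1, ∃ q ∈ Set.Icc (0 : ℝ) 1, x = squarePoint v w z u p q}

/-- The geometric realization of `X`, with the topology of convergence of all the coordinates; as
`X` is locally finite, this is the usual topology of the cube complex. -/
abbrev X : Type := ↥realization

/-- The group of the automorphisms of the cube complex `X`: the permutations of the vertices that
carry edges to edges and squares to squares, and whose inverses do so too. -/
def autSubgroup : Subgroup (Equiv.Perm Grp) where
  carrier := {σ | (∀ v w, IsEdge (σ v) (σ w) ↔ IsEdge v w) ∧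
    ∀ v w z u, IsSquareCell (σ v) (σ w) (σ z) (σ u) ↔ IsSquareCell v w z u}
  one_mem' := ⟨fun _ _ => Iff.rfl, fun _ _ _ _ => Iff.rfl⟩
  mul_mem' := fun {σ τ} hσ hτ =>
    ⟨fun v w => (hσ.1 (τ v) (τ w)).trans (hτ.1 v w),
     fun v w z u => (hσ.2 (τ v) (τ w) (τ z) (τ u)).trans (hτ.2 v w z u)⟩
  inv_mem' := fun {σ} hσ =>
    ⟨fun v w => by simpa using (hσ.1 (σ⁻¹ v) (σ⁻¹ w)).symm,
     fun v w z u => by simpa using (hσ.2 (σ⁻¹ v) (σ⁻¹ w) (σ⁻¹ z) (σ⁻¹ u)).symm⟩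

/-- `Aut(X)`. -/
def Aut : Type := ↥autSubgroup

instance instGroupAut : Group Aut := inferInstanceAs (Group ↥autSubgroup)

/-- The permutation of the vertices that underlies an automorphism. -/
def Aut.toPerm (g : Aut) : Equiv.Perm Grp := Subtype.val g

theorem dirac_comp (g : Aut) (v : Grp) :
    (fun y => dirac v (g.toPerm.symm y)) = dirac (g.toPerm v) := by
  funext y
  by_cases h : y = g.toPerm v
  · subst h
    simp [dirac]
  · have h2 : g.toPerm.symm y ≠ v := fun e => h (by rw [← e]; simp)
    simp [dirac, Set.indicator, h, h2]

theorem squarePoint_comp (g : Aut) (v w z u : Grp) (p q : ℝ) :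
    (fun y => squarePoint v w z u p q (g.toPerm.symm y)) =
      squarePoint (g.toPerm v) (g.toPerm w) (g.toPerm z) (g.toPerm u) p q := by
  funext y
  simp only [squarePoint, ← dirac_comp, Pi.add_apply, Pi.smul_apply]

theorem comp_mem_realization (g : Aut) {x : Grp → ℝ} (hx : x ∈ realization) :
    (fun y => x (g.toPerm.symm y)) ∈ realization := by
  obtain ⟨v, w, z, u, hs, p, hp, q, hq, rfl⟩ := hx
  exact ⟨g.toPerm v, g.toPerm w, g.toPerm z, g.toPerm u, (g.2.2 v w z u).2 hs, p, hp, q, hq,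
    squarePoint_comp g v w z u p q⟩

/-- The self-map of the geometric realization that an automorphism induces: it carries each square
isometrically onto a square, in accordance with what it does to the vertices. -/
def act (g : Aut) : C(X, X) where
  toFun x := ⟨fun y => x.1 (g.toPerm.symm y), comp_mem_realization g x.2⟩
  continuous_toFun := by
    refine Continuous.subtype_mk (continuous_pi fun y => ?_) _
    exact (continuous_apply _).comp continuous_subtype_val

/-- The compact-open topology on `Aut(X)`, for the action on the geometric realization. -/
instance instTopologicalSpaceAut : TopologicalSpace Aut :=
  TopologicalSpace.induced act ContinuousMap.compactOpen

/-- Parallelism of oriented edges `(v, w)`: the equivalence relation generated by being opposite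
sides, with the same direction, of a square. -/
def Parallel : Grp × Grp → Grp × Grp → Prop :=
  Relation.EqvGen fun e f => IsSquareCell e.1 e.2 f.2 f.1

/-- The hyperplane that crosses the edge from `v` to `w`: the union of the midcubes that are dual to
the edges parallel to it. -/
def hyperplane (v w : Grp) : Set X :=
  {x | ∃ v' w' z u, Parallel (v, w) (v', w') ∧ IsSquareCell v' w' z u ∧
    ∃ q ∈ Set.Icc (0 : ℝ) 1, x.1 = squarePoint v' w' z u (1 / 2) q}

/-- The halfspaces of `X`: the connected components of the complements of the hyperplanes. -/
def IsHalfspace (h : Set X) : Prop :=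
  ∃ v w, IsEdge v w ∧ ∃ x ∈ (hyperplane v w)ᶜ, h = connectedComponentIn (hyperplane v w)ᶜ x

/-- `Aut⁺(X)`: the subgroup generated by the automorphisms that fix some halfspace pointwise. -/
def AutPlus : Subgroup Aut :=
  Subgroup.closure {g | ∃ h, IsHalfspace h ∧ ∀ x ∈ h, act g x = x}

end CrokeKleiner

end

noncomputable section

namespace CrokeKleiner

/-! The vertices of `X` are the group elements, and the graph of commuting generators is the path
a–b–c–d. Because of the shape of this path, an automorphism that preserves the label of one edge
preserves all labels (`Aut.labelled_of_edge`). A labelled automorphism is determined by the image of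
one vertex and a sign for each line, equal on parallel lines; conversely every such choice of signs
occurs (`SignData.perm`). This supplies reflections that change the signs of a single parallelism
class.

Walls of label `a` have combinatorial sides `HS u ε`, and the edges crossing such a wall start along
one line of label `b`. An automorphism that fixes a vertex and the `a`- and `b`-lines through it can
be cut along a wall into two factors, each supported in one side; reflections remove the condition
on the signs. As fixing a halfspace pointwise forces an edge to be fixed, `Aut⁺(X)` is generated by
the labelled automorphisms supported in sides of `a`-walls (`autPlus_eq`), and it contains every
labelled automorphism with a fixed vertex.

The compact-open topology is that of pointwise convergence on vertices. The labelled stabilizer of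
the base vertex is open, infinite, and compact, being an image of a closed set of sign functions. So
`Aut⁺(X)` is open and closed, locally compact and non-discrete, and a compact quotient would be
finite. But `toDihedral`, which is blind to signs, is invariant under `Aut⁺(X)` and separates the
translations by powers of `d * a`.

For simplicity, a nontrivial element of a normal subgroup moves some side off itself
(`exists_disjoint_image`). Combined with a conjugate by a reflection it yields an element `m` of the
subgroup that carries a side into a smaller one, and some side `k` has disjoint translates under the
powers of `m`. An element `f` supported in `k` is then a commutator of `m` with the infinite product
of the conjugates of `f` by these powers (`exists_commutator`), so it lies in the subgroup; every
other side can be carried into `k`. -/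

/-! ### Generators, exponent sums and letters. -/

theorem commute_gen {s t : Gen} (h : Linked s t) : Commute (gen s) (gen t) := by
  have key : ∀ x y : Gen, commWord x y ∈ relators → gen x * gen y = gen y * gen x := by
    intro x y hxy
    have h1 : (PresentedGroup.mk relators) (commWord x y) = 1 :=
      PresentedGroup.one_of_mem hxy
    have h2 : gen x * gen y * (gen x)⁻¹ * (gen y)⁻¹ = 1 := by
      simpa [commWord, gen, PresentedGroup.of] using h1
    rwa [mul_inv_eq_one, mul_inv_eq_iff_eq_mul] at h2
  cases h
  · exact key _ _ (by simp [relators])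
  · exact (key _ _ (by simp [relators])).symm
  · exact key _ _ (by simp [relators])
  · exact (key _ _ (by simp [relators])).symm
  · exact key _ _ (by simp [relators])
  · exact (key _ _ (by simp [relators])).symm

theorem Linked.symm {s t : Gen} (h : Linked s t) : Linked t s := by
  cases h <;> constructor

theorem Linked.ne {s t : Gen} (h : Linked s t) : s ≠ t := by
  cases h <;> simp

/-- The homomorphism out of `Grp` given by images of the generators that commute when linked. -/
def lift {G : Type*} [Group G] (f : Gen → G) (hf : ∀ s t, Linked s t → Commute (f s) (f t)) :
    Grp →* G :=
  PresentedGroup.toGroup (f := f) (by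
    have key : ∀ s t, Linked s t → FreeGroup.lift f (commWord s t) = 1 := by
      intro s t h
      simp only [commWord, map_mul, FreeGroup.lift_apply_of, map_inv]
      rw [mul_inv_eq_one, mul_inv_eq_iff_eq_mul]
      exact hf s t h
    intro r hr
    rcases hr with rfl | rfl | rfl
    · exact key _ _ .ab
    · exact key _ _ .bc
    · exact key _ _ .cd)

@[simp] theorem lift_gen {G : Type*} [Group G] (f : Gen → G)
    (hf : ∀ s t, Linked s t → Commute (f s) (f t)) (s : Gen) : lift f hf (gen s) = f s :=
  PresentedGroup.toGroup.of _

theorem closure_range_gen : Subgroup.closure (Set.range gen) = ⊤ :=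
  PresentedGroup.closure_range_of relators

theorem units_cases (η : ℤˣ) : η = 1 ∨ η = -1 := Int.units_eq_one_or η

@[simp] theorem units_mul_self (η : ℤˣ) : (η : ℤ) * (η : ℤ) = 1 := by
  rcases units_cases η with rfl | rfl <;> simp

/-- Induction on the vertices along the edges of `X`, from any base vertex. -/
theorem vertex_induction {P : Grp → Prop} (u : Grp) (h1 : P u)
    (hs : ∀ v s (η : ℤˣ), P v → P (v * gen s ^ (η : ℤ))) (v : Grp) : P v := by
  have key : ∀ x : Grp, P (u * x) := by
    intro x
    have hx : x ∈ Subgroup.closure (Set.range gen) := by simp [closure_range_gen]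
    induction hx using Subgroup.closure_induction_right with
    | one => simpa using h1
    | mul_right x y _ hy ih =>
      obtain ⟨s, rfl⟩ := hy
      simpa [mul_assoc] using hs _ s 1 ih
    | mul_inv_cancel x y _ hy ih =>
      obtain ⟨s, rfl⟩ := hy
      simpa [mul_assoc] using hs _ s (-1) ih
  simpa using key (u⁻¹ * v)

open Classical in
/-- The exponent sum of the generator `s`. -/
def expo (s : Gen) : Grp →* Multiplicative ℤ :=
  lift (fun t => if t = s then Multiplicative.ofAdd 1 else 1) fun _ _ _ => Commute.all _ _

theorem expo_gen_self (s : Gen) : expo s (gen s) = Multiplicative.ofAdd 1 := by simp [expo]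

theorem expo_gen_of_ne {s t : Gen} (h : t ≠ s) : expo s (gen t) = 1 := by simp [expo, h]

theorem expo_zpow_self (s : Gen) (k : ℤ) :
    expo s (gen s ^ k) = Multiplicative.ofAdd k := by
  rw [map_zpow, expo_gen_self, ← ofAdd_zsmul]; simp

theorem expo_zpow_of_ne {s t : Gen} (h : t ≠ s) (k : ℤ) : expo s (gen t ^ k) = 1 := by
  rw [map_zpow, expo_gen_of_ne h, one_zpow]

theorem gen_zpow_injective (s : Gen) : Function.Injective fun k : ℤ => gen s ^ k := by
  intro k l h
  have := congrArg (expo s) h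
  simpa [expo_zpow_self] using this

theorem gen_zpow_inj {s : Gen} {k l : ℤ} : gen s ^ k = gen s ^ l ↔ k = l :=
  (gen_zpow_injective s).eq_iff

theorem isLetter_iff {s : Gen} {x : Grp} : IsLetter s x ↔ ∃ η : ℤˣ, x = gen s ^ (η : ℤ) := by
  constructor
  · rintro (rfl | rfl)
    · exact ⟨1, by simp⟩
    · exact ⟨-1, by simp⟩
  · rintro ⟨η, rfl⟩
    rcases units_cases η with rfl | rfl
    · left; simp
    · right; simp

/-- The label of an edge is determined by the letter. -/
theorem label_unique {s t : Gen} {η θ : ℤˣ} (h : gen s ^ (η : ℤ) = gen t ^ (θ : ℤ)) :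
    s = t ∧ η = θ := by
  have hst : s = t := by
    by_contra hne
    have := congrArg (expo s) h
    rw [expo_zpow_self, expo_zpow_of_ne (Ne.symm hne)] at this
    rw [← ofAdd_zero] at this
    exact η.ne_zero (Multiplicative.ofAdd.injective this)
  subst hst
  exact ⟨rfl, Units.ext (gen_zpow_inj.1 h)⟩

/-! ### Labelled permutations and their signs. -/

/-- A permutation of the vertices that carries each line of label `s` to a line of label `s`,
isometrically. -/
def Labelled (σ : Equiv.Perm Grp) : Prop :=
  ∀ v s, ∃ ε : ℤˣ, ∀ k : ℤ, σ (v * gen s ^ k) = σ v * gen s ^ ((ε : ℤ) * k)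

theorem Labelled.one : Labelled 1 := fun _ _ => ⟨1, by simp⟩

theorem Labelled.mul {σ τ : Equiv.Perm Grp} (hσ : Labelled σ) (hτ : Labelled τ) :
    Labelled (σ * τ) := by
  intro v s
  obtain ⟨ε, hε⟩ := hτ v s
  obtain ⟨δ, hδ⟩ := hσ (τ v) s
  exact ⟨δ * ε, fun k => by simp [hε, hδ, mul_assoc]⟩

theorem Labelled.inv {σ : Equiv.Perm Grp} (hσ : Labelled σ) : Labelled σ⁻¹ := by
  intro v s
  obtain ⟨ε, hε⟩ := hσ (σ⁻¹ v) s
  refine ⟨ε, fun k => ?_⟩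
  rw [Equiv.Perm.inv_eq_iff_eq, hε]
  simp [← mul_assoc]

theorem labelled_mulLeft (x : Grp) : Labelled (Equiv.mulLeft x) :=
  fun _ _ => ⟨1, by simp [mul_assoc]⟩

/-- A bijection that preserves labelled adjacency is isometric on lines. -/
theorem labelled_of_step {σ : Equiv.Perm Grp}
    (h : ∀ v s, ∃ ε : ℤˣ, σ (v * gen s) = σ v * gen s ^ (ε : ℤ)) : Labelled σ := by
  intro v s
  choose e he using fun w => h w s
  -- If the sign changed at `w * gen s`, two consecutive steps from `w` would lead back to `σ w`,
  -- against injectivity.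
  have hstep : ∀ w, e (w * gen s) = e w := by
    intro w
    by_contra hne
    have hneg : e (w * gen s) = - e w := by
      rcases units_cases (e (w * gen s)) with h1 | h1 <;> rcases units_cases (e w) with h2 | h2 <;>
        simp_all
    have h1 : σ (w * gen s * gen s) = σ w := by
      rw [he, he, hneg, mul_assoc, ← zpow_add]; simp
    have h2 := σ.injective h1
    have h3 : gen s ^ (2 : ℤ) = gen s ^ (0 : ℤ) := by
      rw [mul_assoc, mul_eq_left] at h2
      rw [zpow_two, zpow_zero, h2]
    simpa using gen_zpow_inj.1 h3
  have hall : ∀ k : ℤ, e (v * gen s ^ k) = e v := by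
    intro k
    induction k using Int.induction_on with
    | zero => simp
    | succ k ih => rw [zpow_add_one, ← mul_assoc, hstep, ih]
    | pred k ih => rw [← ih, ← hstep, mul_assoc, ← zpow_add_one, sub_add_cancel]
  refine ⟨e v, fun k => ?_⟩
  induction k using Int.induction_on with
  | zero => simp
  | succ k ih => rw [zpow_add_one, ← mul_assoc, he, hall, ih, mul_assoc, ← zpow_add]; ring_nf
  | pred k ih =>
    have h1 := he (v * gen s ^ (-(k : ℤ) - 1))
    rw [mul_assoc, ← zpow_add_one, sub_add_cancel, ih, hall, ← mul_inv_eq_iff_eq_mul] at h1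
    rw [← h1, mul_assoc, ← zpow_neg, ← zpow_add]; ring_nf

open Classical in
/-- The sign with which `σ` acts on the line of label `s` through `v`. -/
def sgn (σ : Equiv.Perm Grp) (s : Gen) (v : Grp) : ℤˣ :=
  if σ (v * gen s) = σ v * gen s then 1 else -1

theorem Labelled.map_zpow {σ : Equiv.Perm Grp} (hσ : Labelled σ) (v : Grp) (s : Gen) (k : ℤ) :
    σ (v * gen s ^ k) = σ v * gen s ^ ((sgn σ s v : ℤ) * k) := by
  obtain ⟨ε, hε⟩ := hσ v s
  have h1 := hε 1
  have : sgn σ s v = ε := by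
    rcases units_cases ε with rfl | rfl
    · simp at h1; simp [sgn, h1]
    · have : ¬ σ (v * gen s) = σ v * gen s := by
        rw [zpow_one] at h1
        rw [h1]
        intro h
        have h2 := mul_left_cancel h
        have h3 := gen_zpow_inj (s := s) (k := -1) (l := 1)
        simp at h2 h3
        exact h3 h2
      simp [sgn, this]
  rw [this, hε]

theorem Labelled.sgn_eq {σ : Equiv.Perm Grp} (hσ : Labelled σ) {v : Grp} {s : Gen} {ε : ℤˣ}
    (h : σ (v * gen s) = σ v * gen s ^ (ε : ℤ)) : sgn σ s v = ε := by
  have h1 := hσ.map_zpow v s 1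
  rw [zpow_one, h, mul_one] at h1
  exact (label_unique (mul_left_cancel h1)).2.symm

theorem Labelled.sgn_mul {σ τ : Equiv.Perm Grp} (hσ : Labelled σ) (hτ : Labelled τ) (s : Gen)
    (v : Grp) : sgn (σ * τ) s v = sgn σ s (τ v) * sgn τ s v := by
  refine (hσ.mul hτ).sgn_eq ?_
  have h := hτ.map_zpow v s 1
  rw [zpow_one] at h
  simp [h, hσ.map_zpow]

theorem Labelled.sgn_zpow_self {σ : Equiv.Perm Grp} (hσ : Labelled σ) (s : Gen) (v : Grp) (k : ℤ) :
    sgn σ s (v * gen s ^ k) = sgn σ s v := by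
  refine hσ.sgn_eq ?_
  rw [mul_assoc, ← zpow_add_one, hσ.map_zpow, hσ.map_zpow, mul_assoc, ← zpow_add]
  ring_nf

/-- The image of `v * gen s * gen t ^ k` can be computed in either order of the two labels; the
exponent sums of `s` in the two results are the two signs. -/
theorem Labelled.sgn_zpow_linked {σ : Equiv.Perm Grp} (hσ : Labelled σ) {s t : Gen}
    (h : Linked s t) (v : Grp) (k : ℤ) : sgn σ s (v * gen t ^ k) = sgn σ s v := by
  have hc : Commute (gen s) (gen t ^ k) := (commute_gen h).zpow_right k
  have h1 := hσ.map_zpow (v * gen t ^ k) s 1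
  have h2 := hσ.map_zpow (v * gen s ^ (1 : ℤ)) t k
  rw [zpow_one, mul_assoc, ← hc.eq, ← mul_assoc] at h1
  rw [zpow_one, h1, hσ.map_zpow, mul_one] at h2
  have h3 := hσ.map_zpow v s 1
  rw [zpow_one, mul_one] at h3
  rw [h3, mul_assoc, mul_assoc] at h2
  have h4 := congrArg (expo s) (mul_left_cancel h2)
  rw [map_mul, map_mul, expo_zpow_self, expo_zpow_self, expo_zpow_of_ne h.ne.symm,
    expo_zpow_of_ne h.ne.symm, one_mul, mul_one] at h4
  exact Units.ext (by simpa using h4)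

theorem Labelled.isEdge {σ : Equiv.Perm Grp} (hσ : Labelled σ) {v w : Grp} (h : IsEdge v w) :
    IsEdge (σ v) (σ w) := by
  obtain ⟨s, x, hx, rfl⟩ := h
  obtain ⟨η, rfl⟩ := isLetter_iff.1 hx
  refine ⟨s, gen s ^ ((sgn σ s v * η : ℤˣ) : ℤ), isLetter_iff.2 ⟨_, rfl⟩, ?_⟩
  rw [hσ.map_zpow]; simp

theorem Labelled.isSquareCell {σ : Equiv.Perm Grp} (hσ : Labelled σ) {v w z u : Grp}
    (h : IsSquareCell v w z u) : IsSquareCell (σ v) (σ w) (σ z) (σ u) := by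
  obtain ⟨s, t, x, y, hst, hx, hy, rfl, rfl, rfl⟩ := h
  obtain ⟨η, rfl⟩ := isLetter_iff.1 hx
  obtain ⟨θ, rfl⟩ := isLetter_iff.1 hy
  refine ⟨s, t, gen s ^ ((sgn σ s v * η : ℤˣ) : ℤ), gen t ^ ((sgn σ t v * θ : ℤˣ) : ℤ), hst,
    isLetter_iff.2 ⟨_, rfl⟩, isLetter_iff.2 ⟨_, rfl⟩, ?_, ?_, ?_⟩
  · rw [hσ.map_zpow]; simp
  · rw [hσ.map_zpow, hσ.map_zpow, hσ.sgn_zpow_linked hst.symm]; simp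
  · rw [hσ.map_zpow]; simp

theorem Labelled.mem_autSubgroup {σ : Equiv.Perm Grp} (hσ : Labelled σ) : σ ∈ autSubgroup := by
  refine ⟨fun v w => ⟨fun h => ?_, hσ.isEdge⟩, fun v w z u => ⟨fun h => ?_, hσ.isSquareCell⟩⟩
  · simpa using hσ.inv.isEdge h
  · simpa using hσ.inv.isSquareCell h

/-- The automorphism of `X` with a given labelled vertex permutation. -/
def Labelled.toAut {σ : Equiv.Perm Grp} (hσ : Labelled σ) : Aut := ⟨σ, hσ.mem_autSubgroup⟩

@[simp] theorem Labelled.toPerm_toAut {σ : Equiv.Perm Grp} (hσ : Labelled σ) :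
    hσ.toAut.toPerm = σ := rfl

@[simp] theorem Aut.toPerm_mul (g h : Aut) : (g * h).toPerm = g.toPerm * h.toPerm := rfl

@[simp] theorem Aut.toPerm_one : (1 : Aut).toPerm = 1 := rfl

@[simp] theorem Aut.toPerm_inv (g : Aut) : (g⁻¹).toPerm = g.toPerm⁻¹ := rfl

theorem Aut.toPerm_injective : Function.Injective Aut.toPerm := Subtype.val_injective

@[ext] theorem Aut.ext {g h : Aut} (H : ∀ v, g.toPerm v = h.toPerm v) : g = h :=
  Aut.toPerm_injective (Equiv.ext H)

/-! ### Constructing automorphisms from signs. -/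

/-- Sign data: a sign for each line of `X`, where parallel lines have the same sign. -/
structure SignData where
  sign : Gen → Grp → ℤˣ
  self : ∀ s v (k : ℤ), sign s (v * gen s ^ k) = sign s v
  linked : ∀ s t, Linked s t → ∀ v (k : ℤ), sign s (v * gen t ^ k) = sign s v

namespace SignData

variable (e : SignData)

theorem self_gen (s : Gen) (v : Grp) : e.sign s (v * gen s) = e.sign s v := by
  simpa using e.self s v 1

theorem linked_gen {s t : Gen} (h : Linked s t) (v : Grp) :
    e.sign s (v * gen t) = e.sign s v := by
  simpa using e.linked s t h v 1

/-- One step along the label `s`, with the second vertex following the first one. -/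
def stepFst (s : Gen) : Equiv.Perm (Grp × Grp) where
  toFun p := (p.1 * gen s, p.2 * gen s ^ (e.sign s p.1 : ℤ))
  invFun p := (p.1 * gen s ^ (-1 : ℤ), p.2 * gen s ^ (-(e.sign s p.1 : ℤ)))
  left_inv p := by
    ext
    · simp
    · simp [e.self_gen]
  right_inv p := by
    ext
    · simp
    · simp only [e.self]; simp

/-- One step along the label `s`, with the first vertex following the second one. -/
def stepSnd (s : Gen) : Equiv.Perm (Grp × Grp) where
  toFun p := (p.1 * gen s ^ (e.sign s p.1 : ℤ), p.2 * gen s)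
  invFun p := (p.1 * gen s ^ (-(e.sign s p.1 : ℤ)), p.2 * gen s ^ (-1 : ℤ))
  left_inv p := by
    ext
    · simp [e.self]
    · simp
  right_inv p := by
    ext
    · simp only [e.self]; simp
    · simp

/-- Signs are constant along linked labels, so the first of two linked steps does not alter the sign
that the second one reads. This is what lets the steps define an action of the group. -/
theorem stepFst_commute {s t : Gen} (h : Linked s t) : Commute (e.stepFst s) (e.stepFst t) := by
  ext p
  · simp [stepFst, mul_assoc, (commute_gen h).eq]
  · simp only [stepFst, Equiv.Perm.coe_mul, Function.comp, Equiv.coe_fn_mk, e.linked_gen h,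
      e.linked_gen h.symm, mul_assoc]
    rw [((commute_gen h).zpow_zpow _ _).eq]

theorem stepSnd_commute {s t : Gen} (h : Linked s t) : Commute (e.stepSnd s) (e.stepSnd t) := by
  ext p
  · simp only [stepSnd, Equiv.Perm.coe_mul, Function.comp, Equiv.coe_fn_mk, e.linked s t h,
      e.linked t s h.symm, mul_assoc]
    rw [((commute_gen h).zpow_zpow _ _).eq]
  · simp [stepSnd, mul_assoc, (commute_gen h).eq]

/-- The right action of `Grp` on pairs of vertices by `stepFst`. -/
def walkFst : Grp →* (Equiv.Perm (Grp × Grp))ᵐᵒᵖ :=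
  lift (fun s => MulOpposite.op (e.stepFst s)) fun _ _ h => (e.stepFst_commute h).op

/-- The right action of `Grp` on pairs of vertices by `stepSnd`. -/
def walkSnd : Grp →* (Equiv.Perm (Grp × Grp))ᵐᵒᵖ :=
  lift (fun s => MulOpposite.op (e.stepSnd s)) fun _ _ h => (e.stepSnd_commute h).op

theorem walkFst_mul_gen (v : Grp) (s : Gen) (p : Grp × Grp) :
    (e.walkFst (v * gen s)).unop p = e.stepFst s ((e.walkFst v).unop p) := by
  simp [walkFst]

theorem walkSnd_mul_gen (v : Grp) (s : Gen) (p : Grp × Grp) :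
    (e.walkSnd (v * gen s)).unop p = e.stepSnd s ((e.walkSnd v).unop p) := by
  simp [walkSnd]

theorem step_units {α : Type*} (f : Grp → α) (F : Gen → Equiv.Perm α)
    (h : ∀ v s, f (v * gen s) = F s (f v)) (v : Grp) (s : Gen) :
    f (v * gen s ^ (-1 : ℤ)) = (F s).symm (f v) := by
  rw [Equiv.eq_symm_apply, ← h]; simp

/-- The vertex map with the given sign data that fixes `1`. -/
def dev (v : Grp) : Grp := ((e.walkFst v).unop (1, 1)).2

/-- The inverse of `dev`. -/
def undev (v : Grp) : Grp := ((e.walkSnd v).unop (1, 1)).1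

/-- The first entry keeps track of the vertex in the source, so that each step reads the sign at the
right vertex. -/
theorem walkFst_fst (v : Grp) : ((e.walkFst v).unop (1, 1)).1 = v := by
  induction v using vertex_induction (u := 1) with
  | h1 => simp
  | hs v s η ih =>
    rcases units_cases η with rfl | rfl
    · simp only [Units.val_one, zpow_one, walkFst_mul_gen]
      simp [stepFst, ih]
    · have := step_units (fun v => (e.walkFst v).unop (1, 1)) e.stepFst
        (fun v s => e.walkFst_mul_gen v s _) v s
      simp only [Units.val_neg, Units.val_one, this]
      simp [stepFst, ih]

@[simp] theorem dev_one : e.dev 1 = 1 := by simp [dev]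

@[simp] theorem undev_one : e.undev 1 = 1 := by simp [undev]

theorem dev_mul (v : Grp) (s : Gen) (η : ℤˣ) :
    e.dev (v * gen s ^ (η : ℤ)) = e.dev v * gen s ^ ((e.sign s v * η : ℤˣ) : ℤ) := by
  have h1 : ∀ v, e.dev (v * gen s) = e.dev v * gen s ^ (e.sign s v : ℤ) := fun v => by
    rw [dev, walkFst_mul_gen]
    simp [dev, stepFst, walkFst_fst]
  rcases units_cases η with rfl | rfl
  · simpa using h1 v
  · have := h1 (v * gen s ^ (-1 : ℤ))
    rw [e.self] at this
    rw [zpow_neg_one, inv_mul_cancel_right] at this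
    rw [this]
    simp

theorem undev_mul (v : Grp) (s : Gen) (η : ℤˣ) :
    e.undev (v * gen s ^ (η : ℤ)) = e.undev v * gen s ^ ((e.sign s (e.undev v) * η : ℤˣ) : ℤ) := by
  have h1 : ∀ v, e.undev (v * gen s) = e.undev v * gen s ^ (e.sign s (e.undev v) : ℤ) :=
    fun v => by
      rw [undev, walkSnd_mul_gen]
      simp [undev, stepSnd]
  rcases units_cases η with rfl | rfl
  · simpa using h1 v
  · have h2 := h1 (v * gen s ^ (-1 : ℤ))
    have h3 : e.sign s (e.undev v) = e.sign s (e.undev (v * gen s ^ (-1 : ℤ))) := by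
      have := congrArg (e.sign s) h2
      rw [e.self] at this
      simpa using this
    rw [← h3] at h2
    rw [zpow_neg_one, inv_mul_cancel_right] at h2
    simp [← mul_inv_eq_of_eq_mul h2]

theorem undev_dev (v : Grp) : e.undev (e.dev v) = v := by
  induction v using vertex_induction (u := 1) with
  | h1 => simp
  | hs v s η ih =>
    rw [dev_mul, undev_mul, ih, ← mul_assoc, Int.units_mul_self, one_mul]

theorem dev_undev (v : Grp) : e.dev (e.undev v) = v := by
  induction v using vertex_induction (u := 1) with
  | h1 => simp
  | hs v s η ih =>
    rw [undev_mul, dev_mul, ih, ← mul_assoc, Int.units_mul_self, one_mul]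

/-- The permutation of the vertices with the given sign data that fixes `1`. -/
def perm : Equiv.Perm Grp := ⟨e.dev, e.undev, e.undev_dev, e.dev_undev⟩

theorem labelled_perm : Labelled e.perm :=
  labelled_of_step fun v s => ⟨e.sign s v, by simpa using! e.dev_mul v s 1⟩

theorem sgn_perm (s : Gen) (v : Grp) : sgn e.perm s v = e.sign s v :=
  e.labelled_perm.sgn_eq (by simpa using! e.dev_mul v s 1)

end SignData

/-- The sign data of a labelled permutation. -/
def Labelled.signData {σ : Equiv.Perm Grp} (hσ : Labelled σ) : SignData :=
  ⟨sgn σ, hσ.sgn_zpow_self, fun _ _ h => hσ.sgn_zpow_linked h⟩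

theorem Labelled.ext_of_sgn {σ τ : Equiv.Perm Grp} (hσ : Labelled σ) (hτ : Labelled τ) {u : Grp}
    (hu : σ u = τ u) (h : ∀ s v, sgn σ s v = sgn τ s v) : σ = τ := by
  ext v
  induction v using vertex_induction u with
  | h1 => exact hu
  | hs v s η ih => rw [hσ.map_zpow, hτ.map_zpow, ih, h]

/-! ### Reflections. -/

/-- The subgroup generated by `s` and the generators linked to it. -/
def starSubgroup (s : Gen) : Subgroup Grp := Subgroup.closure (gen '' {t | t = s ∨ Linked s t})

theorem gen_zpow_mem_star {s t : Gen} (h : t = s ∨ Linked s t) (k : ℤ) :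
    gen t ^ k ∈ starSubgroup s :=
  Subgroup.zpow_mem _ (Subgroup.subset_closure (Set.mem_image_of_mem gen h)) k

open Classical in
/-- The sign data with a negative sign at the lines of label `s` parallel to the one through `u`. -/
def flipData (s : Gen) (u : Grp) : SignData where
  sign t v := if t = s ∧ u⁻¹ * v ∈ starSubgroup s then -1 else 1
  self t v k := by
    by_cases h : t = s
    · subst h
      simp [← mul_assoc, Subgroup.mul_mem_cancel_right _ (gen_zpow_mem_star (.inl rfl) k)]
    · simp [h]
  linked t t' ht v k := by
    by_cases h : t = s
    · subst h
      simp [← mul_assoc, Subgroup.mul_mem_cancel_right _ (gen_zpow_mem_star (.inr ht) k)]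
    · simp [h]

/-- The reflection at the vertex `u` of the line of label `s` through `u`. -/
def flip (s : Gen) (u : Grp) : Equiv.Perm Grp :=
  Equiv.mulLeft u * (flipData s 1).perm * Equiv.mulLeft u⁻¹

theorem labelled_flip (s : Gen) (u : Grp) : Labelled (flip s u) :=
  ((labelled_mulLeft _).mul (flipData s 1).labelled_perm).mul (labelled_mulLeft _)

theorem sgn_mulLeft (x : Grp) (s : Gen) (v : Grp) : sgn (Equiv.mulLeft x) s v = 1 :=
  (labelled_mulLeft x).sgn_eq (by simp [mul_assoc])

open Classical in
theorem sgn_flip (s t : Gen) (u v : Grp) :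
    sgn (flip s u) t v = if t = s ∧ u⁻¹ * v ∈ starSubgroup s then -1 else 1 := by
  rw [flip, Labelled.sgn_mul ((labelled_mulLeft _).mul (flipData s 1).labelled_perm)
    (labelled_mulLeft _), (labelled_mulLeft _).sgn_mul (flipData s 1).labelled_perm,
    sgn_mulLeft, sgn_mulLeft, SignData.sgn_perm]
  simp [flipData]

@[simp] theorem flip_self (s : Gen) (u : Grp) : flip s u u = u := by
  simp [flip, SignData.perm]

theorem sgn_flip_self (s : Gen) (u : Grp) : sgn (flip s u) s u = -1 := by
  simp [sgn_flip, one_mem]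

theorem sgn_flip_of_ne {s t : Gen} (h : t ≠ s) (u v : Grp) : sgn (flip s u) t v = 1 := by
  simp [sgn_flip, h]

/-- A generator that does not occur in the star of `s` is not a member of the star subgroup. -/
theorem expo_of_mem_star {s t : Gen} (h1 : t ≠ s) (h2 : ¬ Linked s t) {x : Grp}
    (hx : x ∈ starSubgroup s) : expo t x = 1 := by
  have : starSubgroup s ≤ (expo t).ker := by
    refine (Subgroup.closure_le _).2 ?_
    rintro _ ⟨r, hr, rfl⟩
    refine expo_gen_of_ne ?_
    rintro rfl
    rcases hr with rfl | hr
    · exact h1 rfl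
    · exact h2 hr
  exact this hx

/-! ### Walls of label `a` and their sides. -/

/-- The lines of label `b`. -/
abbrev bLine : Subgroup Grp := Subgroup.zpowers (gen Gen.b)

open Classical in
/-- One step along the label `s`, with the second entry recording the side of the wall dual to the
edge from `1` to `a`. -/
def wallStep (s : Gen) : Equiv.Perm (Grp × Bool) where
  toFun p := (p.1 * gen s, p.2 ^^ decide (s = Gen.a ∧ p.1 ∈ bLine))
  invFun p := (p.1 * (gen s)⁻¹, p.2 ^^ decide (s = Gen.a ∧ p.1 * (gen s)⁻¹ ∈ bLine))
  left_inv p := by simp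
  right_inv p := by simp

/-- Only the pair of labels `a`, `b` matters: a step along `b` preserves membership in `bLine`,
hence does not affect whether an `a`-step crosses the wall. -/
theorem wallStep_commute {s t : Gen} (h : Linked s t) : Commute (wallStep s) (wallStep t) := by
  have key : ∀ v, v * gen Gen.b ∈ bLine ↔ v ∈ bLine := fun v =>
    Subgroup.mul_mem_cancel_right _ (Subgroup.mem_zpowers _)
  ext p
  · simp [wallStep, mul_assoc, (commute_gen h).eq]
  · cases h <;> simp [wallStep, key]

/-- The right action of `Grp` by `wallStep`. -/
def wallWalk : Grp →* (Equiv.Perm (Grp × Bool))ᵐᵒᵖ :=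
  lift (fun s => MulOpposite.op (wallStep s)) fun _ _ h => (wallStep_commute h).op

theorem wallWalk_mul_gen (v : Grp) (s : Gen) (p : Grp × Bool) :
    (wallWalk (v * gen s)).unop p = wallStep s ((wallWalk v).unop p) := by
  simp [wallWalk]

theorem wallWalk_fst (v : Grp) : ((wallWalk v).unop (1, false)).1 = v := by
  induction v using vertex_induction (u := 1) with
  | h1 => simp
  | hs v s η ih =>
    rcases units_cases η with rfl | rfl
    · simp only [Units.val_one, zpow_one, wallWalk_mul_gen]
      simp [wallStep, ih]
    · have := SignData.step_units (fun v => (wallWalk v).unop (1, false)) wallStep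
        (fun v s => wallWalk_mul_gen v s _) v s
      simp only [Units.val_neg, Units.val_one, this]
      simp [wallStep, ih]

/-- The side of the wall dual to the edge from `1` to `a` on which a vertex lies. -/
def wallSide (v : Grp) : Bool := ((wallWalk v).unop (1, false)).2

open Classical in
theorem wallSide_mul_gen (v : Grp) (s : Gen) :
    wallSide (v * gen s) = (wallSide v ^^ decide (s = Gen.a ∧ v ∈ bLine)) := by
  rw [wallSide, wallWalk_mul_gen]
  simp [wallSide, wallStep, wallWalk_fst]

theorem wallSide_zpow_b (k : ℤ) : wallSide (gen Gen.b ^ k) = false := by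
  have h : ∀ v, wallSide (v * gen Gen.b) = wallSide v := fun v => by simp [wallSide_mul_gen]
  induction k using Int.induction_on with
  | zero => simp [wallSide]
  | succ k ih => rw [zpow_add_one, h, ih]
  | pred k ih => rw [← h, ← zpow_add_one, sub_add_cancel, ih]

theorem wallSide_of_mem {v : Grp} (h : v ∈ bLine) : wallSide v = false := by
  obtain ⟨k, rfl⟩ := h
  exact wallSide_zpow_b k

/-- `S` is the set of the vertices on the far side of the wall dual to the edge of label `a` from
`u` to `u * a ^ ε`: the edges that enter `S` are those parallel to this one. -/
def IsHS (S : Set Grp) (u : Grp) (ε : ℤˣ) : Prop :=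
  ∀ v s (η : ℤˣ), (v ∉ S ∧ v * gen s ^ (η : ℤ) ∈ S) ↔ (s = Gen.a ∧ η = ε ∧ u⁻¹ * v ∈ bLine)

/-- All of `bLine` lies on the near side, and only the `a`-edges issuing from it toggle the side.
Traversed forwards they enter the far side, and backwards they leave it. -/
theorem isHS_wallSide : IsHS {v | wallSide v = true} 1 1 := by
  intro v s η
  rcases units_cases η with rfl | rfl
  · simp only [Set.mem_ofPred_eq, Units.val_one, zpow_one, wallSide_mul_gen, inv_one, one_mul,
      true_and]
    constructor
    · rintro ⟨h1, h2⟩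
      simpa [h1] using h2
    · rintro ⟨rfl, h⟩
      simp [wallSide_of_mem h, h]
  · have h := wallSide_mul_gen (v * (gen s)⁻¹) s
    rw [inv_mul_cancel_right] at h
    have hne : (-1 : ℤˣ) ≠ 1 := by decide
    simp only [Set.mem_ofPred_eq, Units.val_neg, Units.val_one, zpow_neg_one, hne, false_and,
      and_false, iff_false, not_and]
    intro h1 h2
    rw [h2] at h
    classical
    by_cases h3 : s = Gen.a ∧ v * (gen s)⁻¹ ∈ bLine
    · rw [wallSide_of_mem h3.2] at h2
      simp at h2
    · rw [decide_eq_false h3] at h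
      exact h1 (by simpa using h)

theorem commute_a_bLine {x : Grp} (hx : x ∈ bLine) (k : ℤ) : x * gen Gen.a ^ k = gen Gen.a ^ k * x := by
  obtain ⟨l, rfl⟩ := hx
  exact ((commute_gen .ba).zpow_zpow l k).eq

theorem mem_bLine_shift {x : Grp} (ε : ℤˣ) :
    (gen Gen.a ^ (ε : ℤ))⁻¹ * (x * gen Gen.a ^ (ε : ℤ)) ∈ bLine ↔ x ∈ bLine := by
  constructor
  · intro h
    have h1 := commute_a_bLine h (-(ε : ℤ))
    rw [zpow_neg, mul_assoc, mul_inv_cancel_right] at h1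
    have h2 := mul_left_cancel h1
    rw [← h2] at h
    exact h2 ▸ h
  · intro h
    rw [commute_a_bLine h, inv_mul_cancel_left]
    exact h

variable {S S' : Set Grp} {u u' : Grp} {ε ε' : ℤˣ}

theorem IsHS.notMem (h : IsHS S u ε) : u ∉ S :=
  ((h u Gen.a ε).2 ⟨rfl, rfl, by simp⟩).1

theorem IsHS.mem (h : IsHS S u ε) : u * gen Gen.a ^ (ε : ℤ) ∈ S :=
  ((h u Gen.a ε).2 ⟨rfl, rfl, by simp⟩).2

theorem IsHS.compl (h : IsHS S u ε) : IsHS Sᶜ (u * gen Gen.a ^ (ε : ℤ)) (-ε) := by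
  intro v s η
  have h1 := h (v * gen s ^ (η : ℤ)) s (-η)
  have e1 : v * gen s ^ (η : ℤ) * gen s ^ ((-η : ℤˣ) : ℤ) = v := by
    rw [mul_assoc, ← zpow_add]; simp
  rw [e1] at h1
  simp only [Set.mem_compl_iff, not_not]
  rw [and_comm, h1]
  constructor
  · rintro ⟨rfl, rfl, h2⟩
    refine ⟨rfl, by simp, ?_⟩
    have := (mem_bLine_shift (-η)).2 h2
    simpa [mul_assoc] using this
  · rintro ⟨rfl, rfl, h2⟩
    refine ⟨rfl, by simp, ?_⟩
    rw [← mem_bLine_shift ε]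
    simpa [mul_assoc] using h2

/-- An edge that is not parallel to the base edge does not cross the wall. -/
theorem IsHS.mem_iff (h : IsHS S u ε) {v : Grp} {s : Gen} {η : ℤˣ}
    (h1 : ¬(s = Gen.a ∧ η = ε ∧ u⁻¹ * v ∈ bLine))
    (h2 : ¬(s = Gen.a ∧ η = -ε ∧ (u * gen Gen.a ^ (ε : ℤ))⁻¹ * v ∈ bLine)) :
    v * gen s ^ (η : ℤ) ∈ S ↔ v ∈ S := by
  have a1 := h v s η
  have a2 := h.compl v s η
  simp only [Set.mem_compl_iff, not_not] at a2
  tauto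

theorem IsHS.mem_iff_of_ne (h : IsHS S u ε) (v : Grp) {s : Gen} (hs : s ≠ Gen.a) (η : ℤˣ) :
    v * gen s ^ (η : ℤ) ∈ S ↔ v ∈ S :=
  h.mem_iff (fun h => hs h.1) (fun h => hs h.1)

theorem IsHS.mem_iff_bLine (h : IsHS S u ε) (v : Grp) {x : Grp} (hx : x ∈ bLine) :
    v * x ∈ S ↔ v ∈ S := by
  obtain ⟨k, rfl⟩ := hx
  have h1 : ∀ w, w * gen Gen.b ∈ S ↔ w ∈ S := fun w => by
    simpa using h.mem_iff_of_ne w (s := Gen.b) (by simp) 1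
  induction k using Int.induction_on with
  | zero => simp
  | succ k ih => simp only at ih ⊢; rw [zpow_add_one, ← mul_assoc, h1]; exact ih
  | pred k ih =>
    simp only at ih ⊢
    rw [← h1, mul_assoc, ← zpow_add_one, sub_add_cancel]
    exact ih

/-- Both sets omit `u` and are entered, hence also left, through the same edges, so membership
agrees along every path from `u`. -/
theorem IsHS.eq (h : IsHS S u ε) (h' : IsHS S' u' ε) (hu : u⁻¹ * u' ∈ bLine) : S = S' := by
  have huS' : u ∉ S' := by
    intro hm
    have := (h'.mem_iff_bLine u hu).2 hm
    rw [mul_inv_cancel_left] at this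
    exact h'.notMem this
  have key : ∀ v, v ∈ S ↔ v ∈ S' := by
    intro v
    induction v using vertex_induction u with
    | h1 => simp [h.notMem, huS']
    | hs v s η ih =>
      have hb : ∀ w, u⁻¹ * w ∈ bLine ↔ u'⁻¹ * w ∈ bLine := fun w => by
        rw [← Subgroup.mul_mem_cancel_left _ hu (y := u'⁻¹ * w)]; simp [mul_assoc]
      have a1 := h v s η
      have a2 := h' v s η
      have a3 := h (v * gen s ^ (η : ℤ)) s (-η)
      have a4 := h' (v * gen s ^ (η : ℤ)) s (-η)
      have e1 : v * gen s ^ (η : ℤ) * gen s ^ ((-η : ℤˣ) : ℤ) = v := by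
        rw [mul_assoc, ← zpow_add]; simp
      rw [e1] at a3 a4
      rw [hb] at a1 a3
      have b1 := a1.trans a2.symm
      have b3 := a3.trans a4.symm
      clear a1 a2 a3 a4
      tauto
  exact Set.ext key

/-- On a path from `u`, consider the edge at which membership in both sets first holds. If it enters
only one of them, it starts on the `b`-line of that set's base vertex, which would then lie in the
other set. If it enters both, the two base edges are parallel with the same sign. -/
theorem IsHS.disjoint (h : IsHS S u ε) (h' : IsHS S' u' ε') (hu : u ∉ S') (hu' : u' ∉ S)
    (hne : ¬(u⁻¹ * u' ∈ bLine ∧ ε = ε')) : Disjoint S S' := by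
  rw [Set.disjoint_left]
  intro v hv
  have key : ∀ v, ¬(v ∈ S ∧ v ∈ S') := by
    intro v
    induction v using vertex_induction u with
    | h1 => exact fun hm => hu hm.2
    | hs v s η ih =>
      rintro ⟨m1, m2⟩
      by_cases hvS : v ∈ S
      · have hvS' : v ∉ S' := fun hm => ih ⟨hvS, hm⟩
        obtain ⟨-, -, hb⟩ := (h' v s η).1 ⟨hvS', m2⟩
        have := h.mem_iff_bLine u' hb
        rw [mul_inv_cancel_left] at this
        exact hu' (this.1 hvS)
      · obtain ⟨rfl, rfl, hb⟩ := (h v s η).1 ⟨hvS, m1⟩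
        have h1 := h'.mem_iff_bLine u hb
        rw [mul_inv_cancel_left] at h1
        obtain ⟨-, h2, hb'⟩ := (h' v Gen.a η).1 ⟨fun hm => hu (h1.1 hm), m2⟩
        refine hne ⟨?_, h2⟩
        have := mul_mem hb (inv_mem hb')
        simpa [mul_assoc] using this
  exact fun hv' => key v ⟨hv, hv'⟩

theorem Labelled.map_mul_bLine {σ : Equiv.Perm Grp} (hσ : Labelled σ) {u v : Grp} :
    (σ u)⁻¹ * σ v ∈ bLine ↔ u⁻¹ * v ∈ bLine := by
  have key : ∀ {τ : Equiv.Perm Grp}, Labelled τ → ∀ {u v : Grp}, u⁻¹ * v ∈ bLine →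
      (τ u)⁻¹ * τ v ∈ bLine := by
    rintro τ hτ u v ⟨k, hk⟩
    have : v = u * gen Gen.b ^ k := by
      simp only at hk
      rw [hk, mul_inv_cancel_left]
    rw [this, hτ.map_zpow, inv_mul_cancel_left]
    exact ⟨_, rfl⟩
  refine ⟨fun h => ?_, key hσ⟩
  simpa using key hσ.inv h

theorem Labelled.sgn_a_bLine {σ : Equiv.Perm Grp} (hσ : Labelled σ) {u v : Grp}
    (h : u⁻¹ * v ∈ bLine) : sgn σ Gen.a v = sgn σ Gen.a u := by
  obtain ⟨k, hk⟩ := h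
  have : v = u * gen Gen.b ^ k := by
    simp only at hk
    rw [hk, mul_inv_cancel_left]
  rw [this, hσ.sgn_zpow_linked .ab]

theorem IsHS.image (h : IsHS S u ε) {σ : Equiv.Perm Grp} (hσ : Labelled σ) :
    IsHS (σ '' S) (σ u) (sgn σ Gen.a u * ε) := by
  intro v s η
  obtain ⟨w, rfl⟩ := σ.surjective v
  have e1 : σ w * gen s ^ (η : ℤ) = σ (w * gen s ^ ((sgn σ s w * η : ℤˣ) : ℤ)) := by
    rw [hσ.map_zpow]; simp [← mul_assoc]
  rw [e1, σ.injective.mem_set_image, σ.injective.mem_set_image, h, hσ.map_mul_bLine]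
  have e2 : ∀ x : ℤˣ, x * η = ε ↔ η = x * ε := fun x => by
    rcases units_cases x with rfl | rfl
    · simp
    · simp [neg_eq_iff_eq_neg]
  constructor
  · rintro ⟨rfl, h1, h2⟩
    rw [hσ.sgn_a_bLine h2] at h1
    exact ⟨rfl, (e2 _).1 h1, h2⟩
  · rintro ⟨rfl, h1, h2⟩
    refine ⟨rfl, ?_, h2⟩
    rw [hσ.sgn_a_bLine h2]
    exact (e2 _).2 h1

/-- Translation moves the wall of the edge from `1` to `a` to any base vertex; the opposite
direction is a translate of the complement. -/
theorem exists_isHS (u : Grp) (ε : ℤˣ) : ∃ S, IsHS S u ε := by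
  have h1 := isHS_wallSide
  rcases units_cases ε with rfl | rfl
  · exact ⟨_, by simpa [sgn_mulLeft] using h1.image (labelled_mulLeft u)⟩
  · have h2 := h1.compl.image (labelled_mulLeft (u * (gen Gen.a)⁻¹))
    have h3 : Equiv.mulLeft (u * (gen Gen.a)⁻¹) (1 * gen Gen.a ^ ((1 : ℤˣ) : ℤ)) = u := by
      rw [Equiv.coe_mulLeft]; simp
    rw [h3, sgn_mulLeft] at h2
    rw [one_mul] at h2
    exact ⟨_, h2⟩

/-- The vertices on the far side of the wall dual to the edge from `u` to `u * a ^ ε`. -/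
def HS (u : Grp) (ε : ℤˣ) : Set Grp := (exists_isHS u ε).choose

theorem isHS_HS (u : Grp) (ε : ℤˣ) : IsHS (HS u ε) u ε := (exists_isHS u ε).choose_spec

theorem compl_HS (u : Grp) (ε : ℤˣ) : (HS u ε)ᶜ = HS (u * gen Gen.a ^ (ε : ℤ)) (-ε) :=
  (isHS_HS u ε).compl.eq (isHS_HS _ _) (by simp)

theorem image_HS {σ : Equiv.Perm Grp} (hσ : Labelled σ) (u : Grp) (ε : ℤˣ) :
    σ '' HS u ε = HS (σ u) (sgn σ Gen.a u * ε) :=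
  ((isHS_HS u ε).image hσ).eq (isHS_HS _ _) (by simp)

theorem disjoint_HS_neg (u : Grp) (ε : ℤˣ) : Disjoint (HS u ε) (HS u (-ε)) :=
  (isHS_HS u ε).disjoint (isHS_HS u (-ε)) (isHS_HS _ _).notMem (isHS_HS _ _).notMem
    fun h => by rcases units_cases ε with rfl | rfl <;> simp at h

/-- A labelled permutation that fixes the complement of `HS u ε` pointwise also fixes the vertices
of `HS u ε` that have a neighbour outside. -/
theorem fixes_boundary {σ : Equiv.Perm Grp} (hσ : Labelled σ) (h : ∀ v ∉ HS u ε, σ v = v)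
    {v : Grp} {s : Gen} {η : ℤˣ} (h2 : v * gen s ^ (η : ℤ) ∉ HS u ε) : σ v = v := by
  by_cases h1 : v ∈ HS u ε
  · set w := v * gen s ^ (η : ℤ) with hw
    have hv : v = w * gen s ^ ((-η : ℤˣ) : ℤ) := by
      rw [hw, mul_assoc, ← zpow_add]; simp
    obtain ⟨rfl, rfl, hb⟩ := (isHS_HS u ε w s (-η)).1 ⟨h2, hv ▸ h1⟩
    -- The `a`-line through `w` continues outside the side in the other direction. Two adjacent
    -- fixed vertices on it force the sign `1`, so `v`, on the same line, is fixed too.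
    have h3 : w * gen Gen.a ^ (η : ℤ) ∉ HS u (-η) := by
      intro h4
      have := (isHS_HS u (-η) w Gen.a η).1 ⟨h2, h4⟩
      rcases units_cases η with rfl | rfl <;> simp at this
    have h4 := hσ.map_zpow w Gen.a (η : ℤ)
    rw [h _ h3, h _ h2] at h4
    have h5 : gen Gen.a ^ ((1 : ℤ) * η) = gen Gen.a ^ ((sgn σ Gen.a w : ℤ) * η) := by
      rw [one_mul]; exact mul_left_cancel h4
    have h6 : sgn σ Gen.a w = 1 := by
      have := gen_zpow_inj.1 h5
      rcases units_cases (sgn σ Gen.a w) with h | h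
      · exact h
      · rcases units_cases η with rfl | rfl <;> rw [h] at this <;> simp at this
    rw [hv, hσ.map_zpow, h6, h _ h2]
    simp
  · exact h v h1

/-! ### Automorphisms supported in a side of a wall, and glueing. -/

/-- The labelled automorphisms. -/
def labelledAut : Subgroup Aut where
  carrier := {g | Labelled g.toPerm}
  one_mem' := Labelled.one
  mul_mem' := fun h1 h2 => Labelled.mul h1 h2
  inv_mem' := fun h => Labelled.inv h

/-- The labelled automorphisms that fix every vertex outside `S`. -/
def rist (S : Set Grp) : Set Aut := {g | Labelled g.toPerm ∧ ∀ v ∉ S, g.toPerm v = v}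

/-- The subgroup generated by the labelled automorphisms that are supported in a side of a wall of
label `a`. -/
def ristClosure : Subgroup Aut := Subgroup.closure (⋃ (u : Grp) (ε : ℤˣ), rist (HS u ε))

theorem rist_subset (u : Grp) (ε : ℤˣ) : rist (HS u ε) ⊆ ristClosure := fun _ hg =>
  Subgroup.subset_closure (Set.mem_iUnion.2 ⟨u, Set.mem_iUnion.2 ⟨ε, hg⟩⟩)

section Glue

variable {ι : Type*} (S : ι → Set Grp) (f : ι → Equiv.Perm Grp)

open Classical in
/-- The map that agrees with `f i` on `S i` and is the identity elsewhere. -/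
def glueFun (v : Grp) : Grp := if h : ∃ i, v ∈ S i then f h.choose v else v

variable {S f}

theorem glueFun_of_mem (hd : Pairwise fun i j => Disjoint (S i) (S j)) {i : ι} {v : Grp}
    (hv : v ∈ S i) : glueFun S f v = f i v := by
  have h : ∃ i, v ∈ S i := ⟨i, hv⟩
  have : h.choose = i := by
    by_contra hne
    exact Set.disjoint_left.1 (hd hne) h.choose_spec hv
  simp only [glueFun, h, dite_true]
  rw [this]

theorem glueFun_of_notMem {v : Grp} (hv : ∀ i, v ∉ S i) : glueFun S f v = v := by
  have h : ¬ ∃ i, v ∈ S i := by simpa using hv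
  simp [glueFun, h]

theorem glueFun_leftInverse (hd : Pairwise fun i j => Disjoint (S i) (S j))
    (hS : ∀ i v, v ∈ S i → f i v ∈ S i) (v : Grp) :
    glueFun S (fun i => (f i)⁻¹) (glueFun S f v) = v := by
  by_cases h : ∃ i, v ∈ S i
  · obtain ⟨i, hi⟩ := h
    rw [glueFun_of_mem hd hi, glueFun_of_mem hd (hS i v hi)]
    simp
  · have h' : ∀ i, v ∉ S i := by simpa using h
    rw [glueFun_of_notMem h', glueFun_of_notMem h']

/-- The permutation that agrees with `f i` on `S i` and is the identity elsewhere. -/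
def glue (hd : Pairwise fun i j => Disjoint (S i) (S j)) (hS : ∀ i v, v ∈ S i → f i v ∈ S i)
    (hS' : ∀ i v, v ∈ S i → (f i)⁻¹ v ∈ S i) : Equiv.Perm Grp where
  toFun := glueFun S f
  invFun := glueFun S fun i => (f i)⁻¹
  left_inv := glueFun_leftInverse hd hS
  right_inv v := by simpa using glueFun_leftInverse (f := fun i => (f i)⁻¹) hd hS' v

/-- An edge either lies within one piece, where a single `f i` acts, or has both ends fixed, since
an end that lies in a piece is then on its boundary. -/
theorem labelled_glue (hd : Pairwise fun i j => Disjoint (S i) (S j))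
    (hS : ∀ i v, v ∈ S i → f i v ∈ S i) (hS' : ∀ i v, v ∈ S i → (f i)⁻¹ v ∈ S i)
    (hf : ∀ i, Labelled (f i))
    (hb : ∀ i v s (η : ℤˣ), v ∈ S i → v * gen s ^ (η : ℤ) ∉ S i → f i v = v) :
    Labelled (glue hd hS hS') := by
  have fixed : ∀ v s (η : ℤˣ), (∀ i, v ∈ S i → v * gen s ^ (η : ℤ) ∉ S i) →
      glueFun S f v = v := by
    intro v s η h
    by_cases hv : ∃ i, v ∈ S i
    · obtain ⟨i, hi⟩ := hv
      rw [glueFun_of_mem hd hi]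
      exact hb i v s η hi (h i hi)
    · exact glueFun_of_notMem (by simpa using hv)
  refine labelled_of_step fun v s => ?_
  change ∃ ε : ℤˣ, glueFun S f (v * gen s) = glueFun S f v * gen s ^ (ε : ℤ)
  by_cases h : ∃ i, v ∈ S i ∧ v * gen s ∈ S i
  · obtain ⟨i, h1, h2⟩ := h
    rw [glueFun_of_mem hd h1, glueFun_of_mem hd h2]
    refine ⟨sgn (f i) s v, ?_⟩
    have := (hf i).map_zpow v s 1
    rwa [zpow_one, mul_one] at this
  · push Not at h
    refine ⟨1, ?_⟩
    rw [fixed v s 1 (by simpa using h), fixed (v * gen s) s (-1) fun i h1 h2 => ?_]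
    · simp
    · rw [Units.val_neg, Units.val_one, zpow_neg_one, mul_inv_cancel_right] at h2
      exact h i h2 h1

end Glue

theorem image_HS_eq {σ : Equiv.Perm Grp} (hσ : Labelled σ) {u : Grp} {ε : ℤˣ} (hu : σ u = u)
    (hs : sgn σ Gen.a u = 1) : σ '' HS u ε = HS u ε := by
  rw [image_HS hσ, hu, hs, one_mul]

/-- An automorphism that fixes a vertex `u` and the lines of labels `a` and `b` through it is a
product of two automorphisms supported in the two sides of a wall. -/
theorem mem_ristClosure_of_sgn {g : Aut} (hg : Labelled g.toPerm) {u : Grp} (hu : g.toPerm u = u)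
    (ha : sgn g.toPerm Gen.a u = 1) (hb : sgn g.toPerm Gen.b u = 1) : g ∈ ristClosure := by
  have hfix : ∀ x ∈ bLine, ∀ k : ℤ, g.toPerm (u * x * gen Gen.a ^ k) = u * x * gen Gen.a ^ k := by
    rintro _ ⟨l, rfl⟩ k
    rw [hg.map_zpow, hg.map_zpow, hg.sgn_zpow_linked .ab, ha, hb, hu]
    simp
  have himg : g.toPerm '' HS u 1 = HS u 1 := image_HS_eq hg hu ha
  have hmem : ∀ v, g.toPerm v ∈ HS u 1 ↔ v ∈ HS u 1 := fun v => by
    rw [← himg, g.toPerm.injective.mem_set_image, himg]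
  have hmem' : ∀ v, (g.toPerm)⁻¹ v ∈ HS u 1 ↔ v ∈ HS u 1 := fun v => by
    rw [← hmem]; simp
  let S : Unit → Set Grp := fun _ => HS u 1
  have hd : Pairwise fun i j => Disjoint (S i) (S j) := fun i j h => (h rfl).elim
  have h1 : ∀ (i : Unit) v, v ∈ S i → g.toPerm v ∈ S i := fun _ v h => (hmem v).2 h
  have h2 : ∀ (i : Unit) v, v ∈ S i → (g.toPerm)⁻¹ v ∈ S i := fun _ v h => (hmem' v).2 h
  -- The boundary vertices of `HS u 1` are `u * x * gen Gen.a` with `x ∈ bLine`, all fixed by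
  -- `hfix`; so `g` can be replaced by the identity on the other side.
  have hL := labelled_glue (f := fun _ => g.toPerm) hd h1 h2 (fun _ => hg) (by
    intro _ v s η hv hw
    have hv' : v ∉ (HS u 1)ᶜ := fun h => h hv
    obtain ⟨rfl, hη, hx⟩ := ((isHS_HS u 1).compl v s η).1 ⟨hv', hw⟩
    subst hη
    have h3 := (mem_bLine_shift (x := u⁻¹ * (v * gen Gen.a ^ ((-1 : ℤˣ) : ℤ))) 1).1
      (by simpa [mul_assoc] using hx)
    have := hfix _ h3 1
    simpa using this)
  have g1 : hL.toAut ∈ rist (HS u 1) :=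
    ⟨hL, fun v hv => glueFun_of_notMem (S := S) (f := fun _ => g.toPerm) fun _ => hv⟩
  have g2 : (hL.toAut)⁻¹ * g ∈ rist (HS (u * gen Gen.a ^ ((1 : ℤˣ) : ℤ)) (-1)) := by
    refine ⟨hL.inv.mul hg, fun v hv => ?_⟩
    rw [← compl_HS, Set.mem_compl_iff, not_not] at hv
    rw [Aut.toPerm_mul, Aut.toPerm_inv, Labelled.toPerm_toAut, Equiv.Perm.mul_apply,
      Equiv.Perm.inv_eq_iff_eq]
    exact (glueFun_of_mem (S := S) (f := fun _ => g.toPerm) (i := ()) hd hv).symm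
  have := mul_mem (rist_subset _ _ g1) (rist_subset _ _ g2)
  rwa [mul_inv_cancel_left] at this

/-- At `u` itself the sign is `-1`, so the cutting argument is applied at `u * gen Gen.d`: this
vertex is also fixed, and all signs there are `1` because `d` is outside the star of `s`. -/
theorem flip_mem_ristClosure {s : Gen} (hs : s = Gen.a ∨ s = Gen.b) (u : Grp) :
    (labelled_flip s u).toAut ∈ ristClosure := by
  have hd : gen Gen.d ∉ starSubgroup s := by
    intro h
    have h1 : Gen.d ≠ s := by rcases hs with rfl | rfl <;> simp
    have h2 : ¬ Linked s Gen.d := by rcases hs with rfl | rfl <;> rintro ⟨⟩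
    have := expo_of_mem_star h1 h2 h
    rw [expo_gen_self, ← ofAdd_zero] at this
    exact one_ne_zero (Multiplicative.ofAdd.injective this)
  have hsgn : ∀ t, sgn (flip s u) t (u * gen Gen.d) = 1 := fun t => by simp [sgn_flip, hd]
  refine mem_ristClosure_of_sgn (u := u * gen Gen.d) (labelled_flip s u) ?_ (hsgn _) (hsgn _)
  have := (labelled_flip s u).map_zpow u Gen.d 1
  have h1 : sgn (flip s u) Gen.d u = 1 := sgn_flip_of_ne (by rcases hs with rfl | rfl <;> simp) _ _
  simpa [h1] using this

/-- A labelled automorphism that fixes a vertex is a product of automorphisms supported in sides of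
walls of label `a`. -/
theorem mem_ristClosure {g : Aut} (hg : Labelled g.toPerm) {u : Grp} (hu : g.toPerm u = u) :
    g ∈ ristClosure := by
  -- A reflection corrects a negative sign at `u` and affects one label only, so correcting `b` does
  -- not spoil the correction of `a`.
  have step : ∀ s, (s = Gen.a ∨ s = Gen.b) → ∀ g : Aut, Labelled g.toPerm → g.toPerm u = u →
      ∃ r ∈ ristClosure, Labelled (r * g).toPerm ∧ (r * g).toPerm u = u ∧
        sgn (r * g).toPerm s u = 1 ∧ ∀ t, t ≠ s → sgn (r * g).toPerm t u = sgn g.toPerm t u := by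
    intro s hs g hg hu
    rcases units_cases (sgn g.toPerm s u) with h | h
    · exact ⟨1, one_mem _, by simpa using hg, by simpa using hu, by simpa using h, by simp⟩
    · refine ⟨_, flip_mem_ristClosure hs u, (labelled_flip s u).mul hg, by simp [hu], ?_, ?_⟩
      · rw [Aut.toPerm_mul, Labelled.toPerm_toAut, (labelled_flip s u).sgn_mul hg, hu, h,
          sgn_flip_self]; simp
      · intro t ht
        rw [Aut.toPerm_mul, Labelled.toPerm_toAut, (labelled_flip s u).sgn_mul hg,
          sgn_flip_of_ne ht, one_mul]
  obtain ⟨r, hr, l1, f1, s1, -⟩ := step Gen.a (.inl rfl) g hg hu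
  obtain ⟨r', hr', l2, f2, s2, s3⟩ := step Gen.b (.inr rfl) _ l1 f1
  have h := mem_ristClosure_of_sgn l2 f2 ((s3 _ (by simp)).trans s1) s2
  rwa [Subgroup.mul_mem_cancel_left _ hr', Subgroup.mul_mem_cancel_left _ hr] at h

/-! ### Links of vertices and preservation of labels. -/

section Link

theorem linked_iff (s t : Gen) : Linked s t ↔
    (s = .a ∧ t = .b) ∨ (s = .b ∧ t = .a) ∨ (s = .b ∧ t = .c) ∨ (s = .c ∧ t = .b) ∨
      (s = .c ∧ t = .d) ∨ (s = .d ∧ t = .c) := by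
  constructor
  · rintro ⟨⟩ <;> simp
  · rintro (⟨rfl, rfl⟩ | ⟨rfl, rfl⟩ | ⟨rfl, rfl⟩ | ⟨rfl, rfl⟩ | ⟨rfl, rfl⟩ | ⟨rfl, rfl⟩) <;>
      constructor

/-- The labels that have neighbours of two kinds. -/
def IsInner (s : Gen) : Prop := ∃ y y' z, Linked s y ∧ Linked s y' ∧ Linked z y' ∧ ¬ Linked z y

theorem isInner_iff (s : Gen) : IsInner s ↔ s = .b ∨ s = .c := by
  constructor
  · rintro ⟨y, y', z, h1, h2, h3, h4⟩
    cases s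
    · cases h1; cases h2; exact (h4 h3).elim
    · simp
    · simp
    · cases h1; cases h2; exact (h4 h3).elim
  · rintro (rfl | rfl)
    · exact ⟨.a, .c, .d, .ba, .bc, .dc, fun h => by cases h⟩
    · exact ⟨.d, .b, .a, .cd, .cb, .ab, fun h => by cases h⟩

/-- In the path a–b–c–d, adjacency to a given inner vertex, together with being inner or not, tells
the four vertices apart. -/
theorem label_determined {s₀ s s' : Gen} (h₀ : s₀ = .b ∨ s₀ = .c) (h1 : IsInner s ↔ IsInner s')
    (h2 : Linked s s₀ ↔ Linked s' s₀) : s' = s := by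
  rw [isInner_iff, isInner_iff] at h1
  rw [linked_iff, linked_iff] at h2
  rcases h₀ with rfl | rfl <;> cases s <;> cases s' <;> simp at h1 h2 ⊢

/-- A relabelling of the letters that is an isomorphism of links and preserves the label of some
letter preserves all labels. -/
theorem relabel_eq {f : Gen × ℤˣ → Gen} (hf : Function.Surjective f)
    (hl : ∀ p q, Linked p.1 q.1 ↔ Linked (f p) (f q)) {p₀ : Gen × ℤˣ} (h₀ : f p₀ = p₀.1)
    (p : Gen × ℤˣ) : f p = p.1 := by
  have hin : ∀ p, IsInner p.1 ↔ IsInner (f p) := by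
    intro p
    constructor
    · rintro ⟨y, y', z, h1, h2, h3, h4⟩
      exact ⟨f (y, 1), f (y', 1), f (z, 1), (hl p (y, 1)).1 h1, (hl p (y', 1)).1 h2,
        (hl (z, 1) (y', 1)).1 h3, fun h => h4 ((hl (z, 1) (y, 1)).2 h)⟩
    · rintro ⟨y, y', z, h1, h2, h3, h4⟩
      obtain ⟨y, rfl⟩ := hf y
      obtain ⟨y', rfl⟩ := hf y'
      obtain ⟨z, rfl⟩ := hf z
      exact ⟨y.1, y'.1, z.1, (hl _ _).2 h1, (hl _ _).2 h2, (hl _ _).2 h3,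
        fun h => h4 ((hl _ _).1 h)⟩
  have main : ∀ q : Gen × ℤˣ, (q.1 = .b ∨ q.1 = .c) → f q = q.1 → ∀ p, f p = p.1 :=
    fun q hq h p => label_determined hq (hin p) (by rw [hl p q, h])
  by_cases hp : p₀.1 = .b ∨ p₀.1 = .c
  · exact main p₀ hp h₀ p
  · have hb : ∃ s, Linked s p₀.1 ∧ IsInner s ∧
        ∀ s', Linked s' p₀.1 → s' = s := by
      rcases h : p₀.1 with _ | _ | _ | _
      · exact ⟨.b, .ba, by simp [isInner_iff], fun s' h => by cases h; rfl⟩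
      · simp [h] at hp
      · simp [h] at hp
      · exact ⟨.c, .cd, by simp [isInner_iff], fun s' h => by cases h; rfl⟩
    obtain ⟨s, h1, h2, h3⟩ := hb
    refine main (s, 1) ((isInner_iff s).1 h2) (h3 _ ?_) p
    rw [← h₀]
    exact (hl (s, 1) p₀).1 h1

theorem Aut.map_letter (g : Aut) (v : Grp) (p : Gen × ℤˣ) :
    ∃ q : Gen × ℤˣ, g.toPerm (v * gen p.1 ^ (p.2 : ℤ)) = g.toPerm v * gen q.1 ^ (q.2 : ℤ) := by
  have h : IsEdge v (v * gen p.1 ^ (p.2 : ℤ)) := ⟨p.1, _, isLetter_iff.2 ⟨p.2, rfl⟩, rfl⟩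
  obtain ⟨t, x, hx, he⟩ := (g.2.1 _ _).2 h
  obtain ⟨θ, rfl⟩ := isLetter_iff.1 hx
  exact ⟨(t, θ), he⟩

theorem isSquareCell_iff (v : Grp) (p q : Gen × ℤˣ) :
    (∃ z, IsSquareCell v (v * gen p.1 ^ (p.2 : ℤ)) z (v * gen q.1 ^ (q.2 : ℤ))) ↔
      Linked p.1 q.1 := by
  constructor
  · rintro ⟨z, s, t, x, y, hst, hx, hy, h1, -, h2⟩
    obtain ⟨η, rfl⟩ := isLetter_iff.1 hx
    obtain ⟨θ, rfl⟩ := isLetter_iff.1 hy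
    rw [(label_unique (mul_left_cancel h1)).1, (label_unique (mul_left_cancel h2)).1]
    exact hst
  · intro h
    exact ⟨_, p.1, q.1, _, _, h, isLetter_iff.2 ⟨_, rfl⟩, isLetter_iff.2 ⟨_, rfl⟩, rfl, rfl, rfl⟩

/-- Squares at a vertex detect which letters are linked, so `g` induces an isomorphism of links, to
which `relabel_eq` applies. -/
theorem Aut.preserves_labels (g : Aut) {v : Grp} {s : Gen} {η θ : ℤˣ}
    (h : g.toPerm (v * gen s ^ (η : ℤ)) = g.toPerm v * gen s ^ (θ : ℤ)) (p : Gen × ℤˣ) :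
    ∃ θ : ℤˣ, g.toPerm (v * gen p.1 ^ (p.2 : ℤ)) = g.toPerm v * gen p.1 ^ (θ : ℤ) := by
  choose f hf using g.map_letter v
  have hsurj : Function.Surjective fun p => (f p).1 := by
    intro t
    obtain ⟨q, hq⟩ := g⁻¹.map_letter (g.toPerm v) (t, 1)
    refine ⟨q, ?_⟩
    have e : (g.toPerm)⁻¹ (g.toPerm v) = v := by simp
    rw [Aut.toPerm_inv, e] at hq
    have hq := Equiv.Perm.inv_eq_iff_eq.1 hq
    rw [hf q] at hq
    exact (label_unique (mul_left_cancel hq)).1.symm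
  have hl : ∀ p q : Gen × ℤˣ, Linked p.1 q.1 ↔ Linked (f p).1 (f q).1 := by
    intro p q
    rw [← isSquareCell_iff v, ← isSquareCell_iff (g.toPerm v), ← hf, ← hf]
    constructor
    · rintro ⟨z, hz⟩
      exact ⟨g.toPerm z, (g.2.2 _ _ _ _).2 hz⟩
    · rintro ⟨z, hz⟩
      obtain ⟨z, rfl⟩ := g.toPerm.surjective z
      exact ⟨z, (g.2.2 _ _ _ _).1 hz⟩
  have h₀ : (f (s, η)).1 = s := by
    have := hf (s, η)
    rw [h] at this
    exact (label_unique (mul_left_cancel this)).1.symm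
  have := relabel_eq hsurj hl (p₀ := (s, η)) h₀ p
  exact ⟨(f p).2, by rw [hf, this]⟩

/-- An automorphism that preserves the label of one edge preserves all labels. -/
theorem Aut.labelled_of_edge (g : Aut) {v : Grp} {s : Gen} {η θ : ℤˣ}
    (h : g.toPerm (v * gen s ^ (η : ℤ)) = g.toPerm v * gen s ^ (θ : ℤ)) : Labelled g.toPerm := by
  have key : ∀ w, ∃ (s : Gen) (η θ : ℤˣ),
      g.toPerm (w * gen s ^ (η : ℤ)) = g.toPerm w * gen s ^ (θ : ℤ) := by
    intro w
    induction w using vertex_induction v with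
    | h1 => exact ⟨s, η, θ, h⟩
    | hs w t ζ ih =>
      obtain ⟨s, η, θ, h⟩ := ih
      obtain ⟨θ', h'⟩ := g.preserves_labels h (t, ζ)
      refine ⟨t, -ζ, -θ', ?_⟩
      simp only at h'
      rw [h']
      simp
  refine labelled_of_step fun w s => ?_
  obtain ⟨t, η, θ, h⟩ := key w
  obtain ⟨θ', h'⟩ := g.preserves_labels h (s, 1)
  exact ⟨θ', by simpa using h'⟩

end Link

/-! ### Points of squares, and automorphisms that fix a halfspace. -/

section Squares

variable {v w z u : Grp} {p q : ℝ}

theorem IsSquareCell.swap (h : IsSquareCell v w z u) : IsSquareCell v u z w := by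
  obtain ⟨s, t, x, y, hst, hx, hy, rfl, rfl, rfl⟩ := h
  refine ⟨t, s, y, x, hst.symm, hy, hx, rfl, ?_, rfl⟩
  obtain ⟨η, rfl⟩ := isLetter_iff.1 hx
  obtain ⟨θ, rfl⟩ := isLetter_iff.1 hy
  rw [mul_assoc, mul_assoc, ((commute_gen hst).zpow_zpow _ _).eq]

theorem IsSquareCell.reverse (h : IsSquareCell v w z u) : IsSquareCell w v u z := by
  obtain ⟨s, t, x, y, hst, hx, hy, rfl, rfl, rfl⟩ := h
  refine ⟨s, t, x⁻¹, y, hst, ?_, hy, by simp, by simp, rfl⟩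
  rcases hx with rfl | rfl
  · exact .inr rfl
  · exact .inl (inv_inv _)

theorem squarePoint_swap : squarePoint v u z w q p = squarePoint v w z u p q := by
  simp only [squarePoint]
  module

theorem squarePoint_reverse : squarePoint w v u z (1 - p) q = squarePoint v w z u p q := by
  simp only [squarePoint]
  module

theorem IsSquareCell.ne_left (h : IsSquareCell v w z u) : v ≠ w := by
  obtain ⟨s, t, x, y, hst, hx, hy, rfl, rfl, rfl⟩ := h
  obtain ⟨η, rfl⟩ := isLetter_iff.1 hx
  intro h
  have : gen s ^ (η : ℤ) = gen s ^ (0 : ℤ) := by simpa using h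
  exact η.ne_zero (gen_zpow_inj.1 this)

theorem IsSquareCell.ne_diag (h : IsSquareCell v w z u) : v ≠ z := by
  obtain ⟨s, t, x, y, hst, hx, hy, rfl, rfl, rfl⟩ := h
  obtain ⟨η, rfl⟩ := isLetter_iff.1 hx
  obtain ⟨θ, rfl⟩ := isLetter_iff.1 hy
  intro h
  rw [mul_assoc, left_eq_mul] at h
  have := congrArg (expo s) h
  rw [map_mul, expo_zpow_self, expo_zpow_of_ne hst.ne.symm, mul_one, map_one, ← ofAdd_zero] at this
  exact η.ne_zero (Multiplicative.ofAdd.injective this)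

theorem IsSquareCell.ne_right (h : IsSquareCell v w z u) : v ≠ u := h.swap.ne_left

theorem dirac_self (v : Grp) : dirac v v = 1 := by simp [dirac]

theorem dirac_of_ne (h : v ≠ w) : dirac v w = 0 := by simp [dirac, h.symm]

theorem dirac_injective : Function.Injective dirac := by
  intro v w h
  by_contra hne
  have := congrFun h v
  rw [dirac_self, dirac_of_ne (Ne.symm hne)] at this
  exact one_ne_zero this

theorem squarePoint_apply_corner (h : IsSquareCell v w z u) :
    squarePoint v w z u p q v = (1 - p) * (1 - q) := by
  simp [squarePoint, dirac_self, dirac_of_ne h.ne_left.symm, dirac_of_ne h.ne_diag.symm,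
    dirac_of_ne h.ne_right.symm]

theorem squarePoint_apply_second (h : IsSquareCell v w z u) :
    squarePoint v w z u p q w = p * (1 - q) := by
  rw [← squarePoint_reverse, squarePoint_apply_corner h.reverse]; ring

theorem squarePoint_apply_fourth (h : IsSquareCell v w z u) :
    squarePoint v w z u p q u = (1 - p) * q := by
  rw [← squarePoint_swap, squarePoint_apply_second h.swap]; ring

theorem squarePoint_apply_third (h : IsSquareCell v w z u) :
    squarePoint v w z u p q z = p * q := by
  rw [← squarePoint_reverse, squarePoint_apply_fourth h.reverse]; ring

theorem squarePoint_apply_of_ne {y : Grp} (h1 : v ≠ y) (h2 : w ≠ y) (h3 : z ≠ y) (h4 : u ≠ y) :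
    squarePoint v w z u p q y = 0 := by
  simp [squarePoint, dirac_of_ne h1, dirac_of_ne h2, dirac_of_ne h3, dirac_of_ne h4]

/-- In the open quarter of a square at the corner `v`, the coordinate at `v` is the largest. -/
theorem squarePoint_lt_corner (h : IsSquareCell v w z u) (hp : p ∈ Set.Ico (0 : ℝ) (1 / 2))
    (hq : q ∈ Set.Ico (0 : ℝ) (1 / 2)) {y : Grp} (hy : y ≠ v) :
    squarePoint v w z u p q y < squarePoint v w z u p q v := by
  obtain ⟨p0, p1⟩ := hp
  obtain ⟨q0, q1⟩ := hq
  rw [squarePoint_apply_corner h]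
  by_cases h2 : y = w
  · subst h2; rw [squarePoint_apply_second h]; nlinarith
  by_cases h3 : y = z
  · subst h3; rw [squarePoint_apply_third h]; nlinarith
  by_cases h4 : y = u
  · subst h4; rw [squarePoint_apply_fourth h]; nlinarith
  rw [squarePoint_apply_of_ne (Ne.symm hy) (Ne.symm h2) (Ne.symm h3) (Ne.symm h4)]
  nlinarith

/-- On a midcube each coordinate at a corner is shared by two adjacent corners, whereas in an open
quarter the largest coordinate is positive and attained only once. -/
theorem quarter_notMem_hyperplane {v₀ w₀ : Grp} (h : IsSquareCell v w z u)
    (hp : p ∈ Set.Ico (0 : ℝ) (1 / 2)) (hq : q ∈ Set.Ico (0 : ℝ) (1 / 2)) {x : X}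
    (hx : x.1 = squarePoint v w z u p q) : x ∉ hyperplane v₀ w₀ := by
  rintro ⟨v', w', z', u', -, hc, r, -, hr⟩
  have hlt : ∀ y, y ≠ v → x.1 y < x.1 v := fun y hy => by
    rw [hx]; exact squarePoint_lt_corner h hp hq hy
  have hpos : 0 < x.1 v := by
    rw [hx, squarePoint_apply_corner h]
    have := hp.2; have := hq.2
    nlinarith
  have e1 : x.1 v' = (1 / 2) * (1 - r) := by rw [hr, squarePoint_apply_corner hc]; ring
  have e2 : x.1 w' = (1 / 2) * (1 - r) := by rw [hr, squarePoint_apply_second hc]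
  have e3 : x.1 z' = (1 / 2) * r := by rw [hr, squarePoint_apply_third hc]
  have e4 : x.1 u' = (1 / 2) * r := by rw [hr, squarePoint_apply_fourth hc]; ring
  by_cases h1 : v' = v
  · have := hlt w' (fun h => hc.ne_left (h1.trans h.symm))
    rw [← h1] at this; linarith
  by_cases h2 : w' = v
  · have := hlt v' h1
    rw [← h2] at this; linarith
  by_cases h3 : z' = v
  · have := hlt u' (fun h => hc.swap.reverse.ne_right (h.trans h3.symm))
    rw [← h3] at this; linarith
  by_cases h4 : u' = v
  · have := hlt z' h3
    rw [← h4] at this; linarith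
  rw [hr, squarePoint_apply_of_ne h1 h2 h3 h4] at hpos
  exact lt_irrefl _ hpos

theorem squarePoint_mem (h : IsSquareCell v w z u) (hp : p ∈ Set.Icc (0 : ℝ) 1)
    (hq : q ∈ Set.Icc (0 : ℝ) 1) : squarePoint v w z u p q ∈ realization :=
  ⟨v, w, z, u, h, p, hp, q, hq, rfl⟩

/-- Every point lies in a closed quarter of a square. -/
theorem exists_quarter (x : X) : ∃ v w z u, IsSquareCell v w z u ∧
    ∃ p ∈ Set.Icc (0 : ℝ) (1 / 2), ∃ q ∈ Set.Icc (0 : ℝ) (1 / 2), x.1 = squarePoint v w z u p q := by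
  obtain ⟨v, w, z, u, h, p, hp, q, hq, hx⟩ := x.2
  have step : ∃ v w z u, IsSquareCell v w z u ∧
      ∃ p ∈ Set.Icc (0 : ℝ) (1 / 2), ∃ q ∈ Set.Icc (0 : ℝ) 1, x.1 = squarePoint v w z u p q := by
    rcases le_total p (1 / 2) with h1 | h1
    · exact ⟨v, w, z, u, h, p, ⟨hp.1, h1⟩, q, hq, hx⟩
    · exact ⟨w, v, u, z, h.reverse, 1 - p, ⟨by linarith [hp.2], by linarith⟩, q, hq, by
        rw [hx, squarePoint_reverse]⟩
  obtain ⟨v, w, z, u, h, p, hp, q, hq, hx⟩ := step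
  rcases le_total q (1 / 2) with h1 | h1
  · exact ⟨v, w, z, u, h, p, hp, q, ⟨hq.1, h1⟩, hx⟩
  · exact ⟨u, v, w, z, h.swap.reverse, 1 - q, ⟨by linarith [hq.2], by linarith⟩, p, hp, by
      rw [hx, squarePoint_reverse, squarePoint_swap]⟩

/-- Every halfspace contains an open quarter of a square. -/
theorem IsHalfspace.exists_quarter {h : Set X} (hh : IsHalfspace h) :
    ∃ v w z u, IsSquareCell v w z u ∧ ∀ p ∈ Set.Ico (0 : ℝ) (1 / 2), ∀ q ∈ Set.Ico (0 : ℝ) (1 / 2),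
      ∃ x ∈ h, x.1 = squarePoint v w z u p q := by
  obtain ⟨v₀, w₀, -, x, hx, rfl⟩ := hh
  obtain ⟨v, w, z, u, hc, p, hp, q, hq, hxe⟩ := CrokeKleiner.exists_quarter x
  refine ⟨v, w, z, u, hc, ?_⟩
  let Q : Set (ℝ × ℝ) := Set.Ico 0 (1 / 2) ×ˢ Set.Ico 0 (1 / 2)
  -- The given point may lie on the boundary of the closed quarter. Adjoining it to the open quarter
  -- keeps the set connected and still avoids the hyperplane.
  let D : Set (ℝ × ℝ) := insert (p, q) Q
  have hQ : IsPreconnected Q := isPreconnected_Ico.prod isPreconnected_Ico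
  have hcl : closure Q = Set.Icc 0 (1 / 2) ×ˢ Set.Icc 0 (1 / 2) := by
    rw [closure_prod_eq, closure_Ico (by norm_num)]
  have hD : IsPreconnected D := hQ.subset_closure (Set.subset_insert _ _)
    (Set.insert_subset (by rw [hcl]; exact ⟨hp, hq⟩) subset_closure)
  have hsub : D ⊆ Set.Icc 0 1 ×ˢ Set.Icc 0 1 := by
    have : Set.Icc (0 : ℝ) (1 / 2) ⊆ Set.Icc 0 1 := Set.Icc_subset_Icc_right (by norm_num)
    refine Set.insert_subset ⟨this hp, this hq⟩ ?_
    exact Set.prod_mono (Set.Ico_subset_Icc_self.trans this) (Set.Ico_subset_Icc_self.trans this)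
  let φ : D → X := fun r => ⟨squarePoint v w z u r.1.1 r.1.2,
    squarePoint_mem hc (hsub r.2).1 (hsub r.2).2⟩
  have hφ : Continuous φ := by
    refine Continuous.subtype_mk (continuous_pi fun y => ?_) _
    simp only [squarePoint, Pi.add_apply, Pi.smul_apply, smul_eq_mul]
    fun_prop
  have hA : IsPreconnected (Set.range φ) := by
    have : PreconnectedSpace D := isPreconnected_iff_preconnectedSpace.1 hD
    exact isPreconnected_range hφ
  have hxA : x ∈ Set.range φ := ⟨⟨(p, q), Set.mem_insert _ _⟩, Subtype.ext hxe.symm⟩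
  have hAH : Set.range φ ⊆ (hyperplane v₀ w₀)ᶜ := by
    rintro _ ⟨⟨r, hr⟩, rfl⟩
    rcases hr with rfl | hr
    · have : φ ⟨(p, q), Set.mem_insert _ _⟩ = x := Subtype.ext hxe.symm
      exact this ▸ hx
    · exact quarter_notMem_hyperplane hc hr.1 hr.2 rfl
  have hsubset := hA.subset_connectedComponentIn hxA hAH
  intro p' hp' q' hq'
  exact ⟨φ ⟨(p', q'), Set.mem_insert_of_mem _ ⟨hp', hq'⟩⟩, hsubset ⟨_, rfl⟩, rfl⟩

end Squares

theorem act_eq_iff (g : Aut) (x : X) {v w z u : Grp} {p q : ℝ}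
    (hx : x.1 = squarePoint v w z u p q) : act g x = x ↔
      squarePoint (g.toPerm v) (g.toPerm w) (g.toPerm z) (g.toPerm u) p q =
        squarePoint v w z u p q := by
  rw [← squarePoint_comp, Subtype.ext_iff]
  change (fun y => x.1 (g.toPerm.symm y)) = x.1 ↔ _
  rw [hx]

theorem squarePoint_zero_zero (v w z u : Grp) : squarePoint v w z u 0 0 = dirac v := by
  simp [squarePoint]

/-- The automorphisms that fix a halfspace pointwise are labelled and fix a vertex. -/
theorem labelled_of_fixes_halfspace {g : Aut} {h : Set X} (hh : IsHalfspace h)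
    (hg : ∀ x ∈ h, act g x = x) : Labelled g.toPerm ∧ ∃ v, g.toPerm v = v := by
  obtain ⟨v, w, z, u, hc, H⟩ := hh.exists_quarter
  obtain ⟨x, hx, hxe⟩ := H 0 (by norm_num) 0 (by norm_num)
  have h1 := (act_eq_iff g x hxe).1 (hg x hx)
  rw [squarePoint_zero_zero, squarePoint_zero_zero] at h1
  have hv := dirac_injective h1
  -- An interior point of the edge has positive mass at `w`, which forces `w` to be fixed as well.
  obtain ⟨y, hy, hye⟩ := H (1 / 4) (by norm_num) 0 (by norm_num)
  have h2 := (act_eq_iff g y hye).1 (hg y hy)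
  have hw : g.toPerm w = w := by
    have := congrFun h2 w
    rw [squarePoint_apply_second hc, hv] at this
    by_contra hne
    have hvw := hc.ne_left
    simp [squarePoint, dirac_of_ne hvw, dirac_of_ne hne] at this
  obtain ⟨s, t, a, b, hst, ha, hb, rfl, rfl, rfl⟩ := hc
  obtain ⟨η, rfl⟩ := isLetter_iff.1 ha
  exact ⟨g.labelled_of_edge (v := v) (s := s) (η := η) (θ := η) (by rw [hw, hv]), v, hv⟩

theorem autPlus_le_ristClosure : AutPlus ≤ ristClosure := by
  refine (Subgroup.closure_le _).2 ?_
  rintro g ⟨h, hh, hg⟩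
  obtain ⟨h1, v, hv⟩ := labelled_of_fixes_halfspace hh hg
  exact mem_ristClosure h1 hv

/-! ### Combinatorial sides and geometric halfspaces. -/

/-- The points with more than half of their mass on `S`. -/
def heavy (S : Set Grp) : Set X := {x | ∃ F : Finset Grp, ↑F ⊆ S ∧ 1 / 2 < ∑ y ∈ F, x.1 y}

theorem isOpen_heavy (S : Set Grp) : IsOpen (heavy S) := by
  have : heavy S = ⋃ (F : Finset Grp) (_ : ↑F ⊆ S), {x : X | 1 / 2 < ∑ y ∈ F, x.1 y} := by
    ext x; simp [heavy]
  rw [this]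
  refine isOpen_iUnion fun F => isOpen_iUnion fun _ => isOpen_lt continuous_const ?_
  exact continuous_finsetSum _ fun y _ => (continuous_apply y).comp continuous_subtype_val

section

variable {v w z u : Grp} {p q : ℝ}

open Classical in
theorem sum_squarePoint (F : Finset Grp) : ∑ y ∈ F, squarePoint v w z u p q y =
    (1 - p) * (1 - q) * (if v ∈ F then 1 else 0) + p * (1 - q) * (if w ∈ F then 1 else 0) +
      p * q * (if z ∈ F then 1 else 0) + (1 - p) * q * (if u ∈ F then 1 else 0) := by
  have h : ∀ v : Grp, ∑ y ∈ F, dirac v y = if v ∈ F then 1 else 0 := fun v => by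
    simp [dirac, Set.indicator_apply]
  simp only [squarePoint, Pi.add_apply, Pi.smul_apply, smul_eq_mul, Finset.sum_add_distrib,
    ← Finset.mul_sum, h]

theorem sum_le_one (x : X) (F : Finset Grp) : ∑ y ∈ F, x.1 y ≤ 1 := by
  classical
  obtain ⟨v, w, z, u, -, p, ⟨p0, p1⟩, q, ⟨q0, q1⟩, hx⟩ := x.2
  have a1 : 0 ≤ (1 - p) * (1 - q) := mul_nonneg (by linarith) (by linarith)
  have a2 : 0 ≤ p * (1 - q) := mul_nonneg p0 (by linarith)
  have a3 : 0 ≤ p * q := mul_nonneg p0 q0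
  have a4 : 0 ≤ (1 - p) * q := mul_nonneg (by linarith) q0
  have b : ∀ (c : ℝ) (P : Prop) [Decidable P], 0 ≤ c → c * (if P then 1 else 0) ≤ c := by
    intro c P _ hc
    split_ifs <;> simp [hc]
  rw [hx, sum_squarePoint]
  linarith [b _ (v ∈ F) a1, b _ (w ∈ F) a2, b _ (z ∈ F) a3, b _ (u ∈ F) a4]

theorem disjoint_heavy (S : Set Grp) : Disjoint (heavy S) (heavy Sᶜ) := by
  classical
  rw [Set.disjoint_left]
  rintro x ⟨F, hF, h1⟩ ⟨F', hF', h2⟩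
  have hd : Disjoint F F' := Finset.disjoint_left.2 fun y hy hy' => hF' hy' (hF hy)
  have := sum_le_one x (F ∪ F')
  rw [Finset.sum_union hd] at this
  linarith

theorem mem_heavy_of_corners {S : Set Grp} {x : X} (hx : x.1 = squarePoint v w z u p q)
    (hv : v ∈ S) (hw : w ∈ S) (hz : z ∈ S) (hu : u ∈ S) : x ∈ heavy S := by
  classical
  refine ⟨{v, w, z, u}, by simp [Set.insert_subset_iff, hv, hw, hz, hu], ?_⟩
  rw [hx, sum_squarePoint]
  simp only [Finset.mem_insert, Finset.mem_singleton, true_or, or_true, if_true]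
  linarith

theorem mem_heavy_left {S : Set Grp} {x : X} (hx : x.1 = squarePoint v w z u p q)
    (hc : IsSquareCell v w z u) (hv : v ∈ S) (hu : u ∈ S) (hp : p < 1 / 2) : x ∈ heavy S := by
  classical
  refine ⟨{v, u}, by simp [Set.insert_subset_iff, hv, hu], ?_⟩
  rw [hx, sum_squarePoint]
  have h1 := hc.ne_left.symm
  have h2 := hc.reverse.ne_diag
  have h3 := hc.ne_diag.symm
  have h5 : z ≠ u := hc.swap.reverse.ne_right.symm
  simp only [Finset.mem_insert, Finset.mem_singleton, true_or, or_true, if_true, h1, h2, h3, h5,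
    or_self, if_false]
  linarith

theorem heavy_exists_corner {S : Set Grp} {x : X} (hx : x.1 = squarePoint v w z u p q)
    (h : x ∈ heavy S) : v ∈ S ∨ w ∈ S ∨ z ∈ S ∨ u ∈ S := by
  classical
  obtain ⟨F, hF, hlt⟩ := h
  rw [hx, sum_squarePoint] at hlt
  by_contra! hcon
  obtain ⟨h1, h2, h3, h4⟩ := hcon
  have hF' : ∀ y ∉ S, y ∉ F := fun y hy h => hy (hF h)
  rw [if_neg (hF' v h1), if_neg (hF' w h2), if_neg (hF' z h3), if_neg (hF' u h4)] at hlt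
  norm_num at hlt

end

/-- The edges of the hyperplane dual to an edge of label `a` from `u`. -/
theorem parallel_bLine (u : Grp) (ε : ℤˣ) {x : Grp} (hx : x ∈ bLine) :
    Parallel (u, u * gen Gen.a ^ (ε : ℤ)) (u * x, u * x * gen Gen.a ^ (ε : ℤ)) := by
  have step : ∀ v, Parallel (v, v * gen Gen.a ^ (ε : ℤ))
      (v * gen Gen.b, v * gen Gen.b * gen Gen.a ^ (ε : ℤ)) := by
    intro v
    refine .rel _ _ ⟨.a, .b, _, _, .ab, isLetter_iff.2 ⟨ε, rfl⟩, .inl rfl, rfl, ?_, rfl⟩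
    have := ((commute_gen .ba).zpow_right (ε : ℤ)).eq
    simp only [mul_assoc, this]
  obtain ⟨k, rfl⟩ := hx
  induction k using Int.induction_on with
  | zero => simpa using! Relation.EqvGen.refl (u, u * gen Gen.a ^ (ε : ℤ))
  | succ k ih =>
    refine ih.trans _ _ _ ?_
    simp only [zpow_add_one, ← mul_assoc]
    exact step _
  | pred k ih =>
    refine ih.trans _ _ _ (.symm _ _ ?_)
    have := step (u * gen Gen.b ^ (-(k : ℤ) - 1))
    rw [mul_assoc u _ (gen Gen.b), ← zpow_add_one, sub_add_cancel] at this
    exact this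

/-- A point outside the hyperplane has more than half of its mass on one side. -/
theorem mem_heavy_or {u₀ : Grp} {ε : ℤˣ} {x : X}
    (hx : x ∉ hyperplane u₀ (u₀ * gen Gen.a ^ (ε : ℤ))) :
    x ∈ heavy (HS u₀ ε) ∨ x ∈ heavy (HS u₀ ε)ᶜ := by
  have hS := isHS_HS u₀ ε
  have hb : ∀ v {t : Gen} {y : Grp}, t ≠ .a → IsLetter t y → (v * y ∈ HS u₀ ε ↔ v ∈ HS u₀ ε) := by
    intro v t y ht hy
    obtain ⟨θ, rfl⟩ := isLetter_iff.1 hy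
    exact hS.mem_iff_of_ne v ht θ
  obtain ⟨v, w, z, u, hc, p, hp, q, hq, hxe⟩ := x.2
  have same : ∀ {v w z u : Grp} {p q : ℝ}, x.1 = squarePoint v w z u p q →
      (w ∈ HS u₀ ε ↔ v ∈ HS u₀ ε) → (z ∈ HS u₀ ε ↔ v ∈ HS u₀ ε) → (u ∈ HS u₀ ε ↔ v ∈ HS u₀ ε) →
      x ∈ heavy (HS u₀ ε) ∨ x ∈ heavy (HS u₀ ε)ᶜ := by
    intro v w z u p q hxe h1 h2 h3
    by_cases h : v ∈ HS u₀ ε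
    · exact .inl (mem_heavy_of_corners hxe h (h1.2 h) (h2.2 h) (h3.2 h))
    · exact .inr (mem_heavy_of_corners hxe h (mt h1.1 h) (mt h2.1 h) (mt h3.1 h))
  have cross : ∀ {v : Grp} {η : ℤˣ} {t : Gen} {y : Grp} {p q : ℝ}, t ≠ .a → IsLetter t y →
      IsSquareCell v (v * gen Gen.a ^ (η : ℤ)) (v * gen Gen.a ^ (η : ℤ) * y) (v * y) →
      q ∈ Set.Icc (0 : ℝ) 1 → v ∉ HS u₀ ε → v * gen Gen.a ^ (η : ℤ) ∈ HS u₀ ε →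
      x.1 = squarePoint v (v * gen Gen.a ^ (η : ℤ)) (v * gen Gen.a ^ (η : ℤ) * y) (v * y) p q →
      x ∈ heavy (HS u₀ ε) ∨ x ∈ heavy (HS u₀ ε)ᶜ := by
    intro v η t y p q ht hy hc hq hv hw hxe
    obtain ⟨-, rfl, hl⟩ := (hS v Gen.a η).1 ⟨hv, hw⟩
    -- Only `p = 1 / 2` lies on the hyperplane; otherwise one of the two edges along the wall
    -- carries more than half of the mass.
    rcases lt_trichotomy p (1 / 2) with h | rfl | h
    · exact .inr (mem_heavy_left hxe hc hv (mt (hb v ht hy).1 hv) h)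
    · refine (hx ⟨_, _, _, _, ?_, hc, q, hq, hxe⟩).elim
      simpa using parallel_bLine u₀ η hl
    · rw [← squarePoint_reverse] at hxe
      exact .inl (mem_heavy_left hxe hc.reverse hw ((hb _ ht hy).2 hw) (by linarith))
  have main : ∀ {v w z u : Grp} {p q : ℝ} {t : Gen} {x' y : Grp}, t ≠ .a → IsLetter .a x' →
      IsLetter t y → w = v * x' → z = v * x' * y → u = v * y → IsSquareCell v w z u →
      q ∈ Set.Icc (0 : ℝ) 1 → x.1 = squarePoint v w z u p q →
      x ∈ heavy (HS u₀ ε) ∨ x ∈ heavy (HS u₀ ε)ᶜ := by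
    rintro v _ _ _ p q t x' y ht hx' hy rfl rfl rfl hc hq hxe
    obtain ⟨η, rfl⟩ := isLetter_iff.1 hx'
    by_cases h : v * gen Gen.a ^ (η : ℤ) ∈ HS u₀ ε ↔ v ∈ HS u₀ ε
    · exact same hxe h ((hb _ ht hy).trans h) (hb _ ht hy)
    · by_cases hv : v ∈ HS u₀ ε
      · have hw : v * gen Gen.a ^ (η : ℤ) ∉ HS u₀ ε := by tauto
        have e : v = v * gen Gen.a ^ (η : ℤ) * gen Gen.a ^ ((-η : ℤˣ) : ℤ) := by simp
        rw [← squarePoint_reverse] at hxe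
        have hc' := hc.reverse
        set w := v * gen Gen.a ^ (η : ℤ)
        rw [e] at hxe hc' hv
        exact cross ht hy hc' hq hw hv hxe
      · exact cross ht hy hc hq hv (by tauto) hxe
  obtain ⟨s, t, x', y, hst, hx', hy, h1, h2, h3⟩ := id hc
  by_cases hs : s = .a
  · subst hs
    exact main hst.ne.symm hx' hy h1 h2 h3 hc hq hxe
  · by_cases ht : t = .a
    · subst ht
      refine main hs hy hx' h3 ?_ h1 hc.swap hp (by rw [hxe, squarePoint_swap])
      obtain ⟨η, rfl⟩ := isLetter_iff.1 hx'
      obtain ⟨θ, rfl⟩ := isLetter_iff.1 hy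
      rw [h2, mul_assoc, mul_assoc, ((commute_gen hst).zpow_zpow _ _).eq]
    · subst h1 h2 h3
      exact same hxe (hb _ hs hx') ((hb _ ht hy).trans (hb _ hs hx')) (hb _ ht hy)

/-- Every corner of a square with a corner outside `HS u ε` is fixed by the automorphisms supported
in `HS u ε`. -/
theorem fixes_square {g : Aut} {u₀ : Grp} {ε : ℤˣ} (hg : g ∈ rist (HS u₀ ε)) {v w z u : Grp}
    (hc : IsSquareCell v w z u) (hv : v ∉ HS u₀ ε) :
    g.toPerm v = v ∧ g.toPerm w = w ∧ g.toPerm z = z ∧ g.toPerm u = u := by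
  obtain ⟨hl, hf⟩ := hg
  have hnb : ∀ v (s : Gen) (η : ℤˣ), v ∉ HS u₀ ε →
      g.toPerm (v * gen s ^ (η : ℤ)) = v * gen s ^ (η : ℤ) := fun v s η hv =>
    fixes_boundary hl hf (s := s) (η := -η) (by simpa using hv)
  obtain ⟨s, t, x, y, hst, hx, hy, rfl, rfl, rfl⟩ := hc
  obtain ⟨η, rfl⟩ := isLetter_iff.1 hx
  obtain ⟨θ, rfl⟩ := isLetter_iff.1 hy
  refine ⟨hf v hv, hnb v s η hv, ?_, hnb v t θ hv⟩
  -- Only edges of label `a` enter the side, so the two neighbours of `v` in the square cannot both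
  -- lie in it; one outside makes `z` a neighbour of the complement.
  by_cases h1 : v * gen s ^ (η : ℤ) ∈ HS u₀ ε
  · by_cases h2 : v * gen t ^ (θ : ℤ) ∈ HS u₀ ε
    · have e1 := ((isHS_HS u₀ ε v s η).1 ⟨hv, h1⟩).1
      have e2 := ((isHS_HS u₀ ε v t θ).1 ⟨hv, h2⟩).1
      exact (hst.ne (e1.trans e2.symm)).elim
    · rw [mul_assoc, ((commute_gen hst).zpow_zpow _ _).eq, ← mul_assoc]
      exact hnb _ s η h2
  · exact hnb _ t θ h1

/-- The component of `u₀` in the complement of the hyperplane is connected, so it stays in the heavy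
set of the complement of `HS u₀ ε`. Hence each of its points lies in a square with a corner outside
the side, and such squares are fixed. -/
theorem rist_subset_autPlus (u₀ : Grp) (ε : ℤˣ) : rist (HS u₀ ε) ⊆ AutPlus := by
  intro g hg
  refine Subgroup.subset_closure ?_
  set w₀ := u₀ * gen Gen.a ^ (ε : ℤ) with hw₀
  have hc : IsSquareCell u₀ w₀ (w₀ * gen Gen.b) (u₀ * gen Gen.b) :=
    ⟨.a, .b, _, _, .ab, isLetter_iff.2 ⟨ε, rfl⟩, .inl rfl, rfl, rfl, rfl⟩
  let x₀ : X := ⟨dirac u₀, squarePoint_zero_zero u₀ w₀ (w₀ * gen Gen.b) (u₀ * gen Gen.b) ▸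
    squarePoint_mem hc (by norm_num) (by norm_num)⟩
  have hx₀e : x₀.1 = squarePoint u₀ w₀ (w₀ * gen Gen.b) (u₀ * gen Gen.b) 0 0 :=
    (squarePoint_zero_zero _ _ _ _).symm
  have hx₀ : x₀ ∈ (hyperplane u₀ w₀)ᶜ :=
    quarter_notMem_hyperplane hc (by norm_num) (by norm_num) hx₀e
  refine ⟨_, ⟨u₀, w₀, ⟨.a, _, isLetter_iff.2 ⟨ε, rfl⟩, rfl⟩, x₀, hx₀, rfl⟩, ?_⟩
  have hu₀ : u₀ ∈ (HS u₀ ε)ᶜ := (isHS_HS u₀ ε).notMem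
  have hsub : connectedComponentIn (hyperplane u₀ w₀)ᶜ x₀ ⊆ heavy (HS u₀ ε)ᶜ := by
    refine isPreconnected_connectedComponentIn.subset_right_of_subset_union (isOpen_heavy _)
      (isOpen_heavy _) (disjoint_heavy (HS u₀ ε)) ?_ ?_
    · exact fun x hx => mem_heavy_or (connectedComponentIn_subset _ _ hx)
    · refine ⟨x₀, mem_connectedComponentIn hx₀, ?_⟩
      have hbu : u₀ * gen Gen.b ∈ (HS u₀ ε)ᶜ := by
        have := (isHS_HS u₀ ε).mem_iff_of_ne u₀ (s := .b) (by simp) 1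
        rw [Units.val_one, zpow_one] at this
        exact mt this.1 hu₀
      exact mem_heavy_left hx₀e hc hu₀ hbu (by norm_num)
  intro x hx
  obtain ⟨v, w, z, u, hc, p, -, q, -, hxe⟩ := x.2
  rw [act_eq_iff g x hxe]
  have : g.toPerm v = v ∧ g.toPerm w = w ∧ g.toPerm z = z ∧ g.toPerm u = u := by
    rcases heavy_exists_corner hxe (hsub hx) with h | h | h | h
    · exact fixes_square hg hc h
    · have := fixes_square hg hc.reverse h
      tauto
    · have := fixes_square hg hc.reverse.swap.reverse h
      tauto
    · have := fixes_square hg hc.swap.reverse h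
      tauto
  rw [this.1, this.2.1, this.2.2.1, this.2.2.2]

theorem autPlus_eq : AutPlus = ristClosure := by
  refine le_antisymm autPlus_le_ristClosure ((Subgroup.closure_le _).2 ?_)
  exact Set.iUnion_subset fun u => Set.iUnion_subset fun ε => rist_subset_autPlus u ε

/-- A labelled automorphism that fixes a vertex lies in `Aut⁺(X)`. -/
theorem mem_autPlus {g : Aut} (hg : Labelled g.toPerm) {u : Grp} (hu : g.toPerm u = u) :
    g ∈ AutPlus :=
  autPlus_eq ▸ mem_ristClosure hg hu

theorem labelled_of_mem_autPlus {g : Aut} (hg : g ∈ AutPlus) : Labelled g.toPerm := by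
  have : ristClosure ≤ labelledAut := (Subgroup.closure_le _).2
    (Set.iUnion_subset fun u => Set.iUnion_subset fun ε => fun g hg => hg.1)
  exact this (autPlus_eq ▸ hg)

/-! ### The topology of the automorphism group. -/

/-- The vertices with the discrete topology. -/
instance : TopologicalSpace Grp := ⊥

instance : DiscreteTopology Grp := ⟨rfl⟩

/-- By currying, joint continuity of the action suffices. The coordinate at `w` of the image is the
coordinate at its preimage `v`, and `v` remains the preimage for all nearby parameters. -/
theorem continuous_act_of_continuous {Y : Type*} [TopologicalSpace Y] {f : Y → Aut}
    (hf : ∀ v, Continuous fun y => (f y).toPerm v) : Continuous f := by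
  refine continuous_induced_rng.2 ?_
  refine ContinuousMap.continuous_of_continuous_uncurry _ ?_
  refine Continuous.subtype_mk (continuous_pi fun w => ?_) _
  change Continuous fun r : Y × X => r.2.1 ((f r.1).toPerm.symm w)
  rw [continuous_iff_continuousAt]
  rintro ⟨y, x⟩
  set v := (f y).toPerm.symm w with hv
  have h1 : Continuous fun r : Y × X => r.2.1 v :=
    (continuous_apply v).comp (continuous_subtype_val.comp continuous_snd)
  refine h1.continuousAt.congr ?_
  have h2 : ∀ᶠ r : Y × X in 𝓝 (y, x), (f r.1).toPerm v = w := by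
    have h3 : IsOpen {r : Y × X | (f r.1).toPerm v = w} :=
      (isOpen_discrete {w}).preimage ((hf v).comp continuous_fst)
    exact h3.mem_nhds (by simp [hv])
  filter_upwards [h2] with r hr
  rw [← hr]; simp

theorem dirac_mem (v : Grp) : dirac v ∈ realization := by
  rw [← squarePoint_zero_zero v (v * gen .a) (v * gen .a * gen .b) (v * gen .b)]
  exact squarePoint_mem ⟨.a, .b, _, _, .ab, .inl rfl, .inl rfl, rfl, rfl, rfl⟩ (by norm_num)
    (by norm_num)

theorem continuous_toPerm (v : Grp) : Continuous fun g : Aut => g.toPerm v := by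
  have h1 : Continuous fun g : Aut => act g ⟨dirac v, dirac_mem v⟩ :=
    (ContinuousEvalConst.continuous_eval_const _).comp continuous_induced_dom
  have h2 : ∀ w, Continuous fun g : Aut => dirac (g.toPerm v) w := by
    intro w
    have := (continuous_apply w).comp (continuous_subtype_val.comp h1)
    refine this.congr fun g => ?_
    exact congrFun (dirac_comp g v) w
  rw [continuous_discrete_rng]
  intro w
  have : (fun g : Aut => g.toPerm v) ⁻¹' {w} = {g | 1 / 2 < dirac (g.toPerm v) w} := by
    ext g
    by_cases h : g.toPerm v = w
    · simp [h, dirac_self]; norm_num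
    · simp [h, dirac_of_ne h]
  rw [this]
  exact isOpen_lt continuous_const (h2 w)

theorem continuous_iff_toPerm {Y : Type*} [TopologicalSpace Y] {f : Y → Aut} :
    Continuous f ↔ ∀ v, Continuous fun y => (f y).toPerm v :=
  ⟨fun h v => (continuous_toPerm v).comp h, continuous_act_of_continuous⟩

theorem isOpen_toPerm_eq (v w : Grp) : IsOpen {g : Aut | g.toPerm v = w} :=
  (isOpen_discrete {w}).preimage (continuous_toPerm v)

instance instIsTopologicalGroupAut : IsTopologicalGroup Aut where
  continuous_mul := by
    refine continuous_iff_toPerm.2 fun v => ?_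
    rw [continuous_discrete_rng]
    intro w
    have : (fun r : Aut × Aut => (r.1 * r.2).toPerm v) ⁻¹' {w} =
        ⋃ u, {g : Aut | g.toPerm u = w} ×ˢ {g : Aut | g.toPerm v = u} := by
      ext r; simp
    rw [this]
    exact isOpen_iUnion fun u => (isOpen_toPerm_eq u w).prod (isOpen_toPerm_eq v u)
  continuous_inv := by
    refine continuous_iff_toPerm.2 fun v => ?_
    rw [continuous_discrete_rng]
    intro w
    have : (fun g : Aut => (g⁻¹).toPerm v) ⁻¹' {w} = {g : Aut | g.toPerm w = v} := by
      ext g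
      simp only [Set.mem_preimage, Set.mem_singleton_iff, Aut.toPerm_inv, Set.mem_ofPred_eq]
      rw [Equiv.Perm.inv_eq_iff_eq, eq_comm]
    rw [this]
    exact isOpen_toPerm_eq w v

theorem aut_injective_coe : Function.Injective fun (g : Aut) (v : Grp) => g.toPerm v :=
  fun _ _ h => Aut.ext (congrFun h)

instance : T2Space Aut :=
  T2Space.of_injective_continuous aut_injective_coe (continuous_pi continuous_toPerm)

instance : TotallyDisconnectedSpace Aut :=
  ⟨(isTotallyDisconnected_of_image (continuous_pi continuous_toPerm).continuousOn
    aut_injective_coe (isTotallyDisconnected_of_totallyDisconnectedSpace _) :)⟩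

/-- The labelled automorphisms that fix the base vertex. -/
def baseStabilizer : Subgroup Aut where
  carrier := {g | Labelled g.toPerm ∧ g.toPerm 1 = 1}
  one_mem' := ⟨Labelled.one, rfl⟩
  mul_mem' := fun {g h} hg hh => ⟨hg.1.mul hh.1, by simp [hg.2, hh.2]⟩
  inv_mem' := fun {g} hg => ⟨hg.1.inv, by rw [Aut.toPerm_inv, Equiv.Perm.inv_eq_iff_eq, hg.2]⟩

theorem baseStabilizer_le : baseStabilizer ≤ AutPlus := fun _ hg => mem_autPlus hg.1 hg.2

/-- Fixing both ends of one edge is an open condition, and it already forces all labels to be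
preserved. -/
theorem isOpen_baseStabilizer : IsOpen (baseStabilizer : Set Aut) := by
  refine Subgroup.isOpen_of_mem_nhds _ (g := 1) ?_
  have h := (isOpen_toPerm_eq 1 1).inter (isOpen_toPerm_eq (gen .a) (gen .a))
  refine Filter.mem_of_superset (h.mem_nhds ⟨rfl, rfl⟩) ?_
  rintro g ⟨h1, h2⟩
  simp only [Set.mem_ofPred_eq] at h1 h2
  exact ⟨g.labelled_of_edge (v := 1) (s := .a) (η := 1) (θ := 1) (by simp [h1, h2]), h1⟩

theorem isOpen_autPlus : IsOpen (AutPlus : Set Aut) :=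
  Subgroup.isOpen_mono baseStabilizer_le isOpen_baseStabilizer

theorem isClosed_autPlus : IsClosed (AutPlus : Set Aut) :=
  Subgroup.isClosed_of_isOpen _ isOpen_autPlus

/-- The set of sign functions that are sign data. -/
def signSet : Set (Gen → Grp → ℤˣ) :=
  {f | (∀ s v (k : ℤ), f s (v * gen s ^ k) = f s v) ∧
    ∀ s t, Linked s t → ∀ v (k : ℤ), f s (v * gen t ^ k) = f s v}

/-- The conditions are equalities between coordinates, hence closed in a product of two-point
spaces. -/
theorem isCompact_signSet : IsCompact signSet := by
  refine IsClosed.isCompact ?_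
  have h : ∀ (s : Gen) (v w : Grp), IsClosed {f : Gen → Grp → ℤˣ | f s v = f s w} :=
    fun s v w => isClosed_eq (by fun_prop) (by fun_prop)
  simp only [signSet, Set.ofPred_and, Set.ofPred_forall]
  exact (isClosed_iInter fun s => isClosed_iInter fun v => isClosed_iInter fun k => h _ _ _).inter
    (isClosed_iInter fun s => isClosed_iInter fun t => isClosed_iInter fun _ =>
      isClosed_iInter fun v => isClosed_iInter fun k => h _ _ _)

/-- The automorphism with given sign data that fixes the base vertex. -/
def ofSigns (f : signSet) : Aut := (SignData.mk f.1 f.2.1 f.2.2).labelled_perm.toAut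

theorem continuous_ofSigns : Continuous ofSigns := by
  refine continuous_iff_toPerm.2 fun v => ?_
  change Continuous fun f : signSet => (SignData.mk f.1 f.2.1 f.2.2).dev v
  induction v using vertex_induction (u := 1) with
  | h1 => simpa using continuous_const
  | hs v s η ih =>
    simp only [SignData.dev_mul]
    have h : Continuous fun f : signSet => f.1 s v :=
      (continuous_apply v).comp ((continuous_apply s).comp continuous_subtype_val)
    exact (continuous_of_discreteTopology
      (f := fun r : Grp × ℤˣ => r.1 * gen s ^ ((r.2 * η : ℤˣ) : ℤ))).comp (ih.prodMk h)

theorem range_ofSigns : Set.range ofSigns = baseStabilizer := by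
  ext g
  constructor
  · rintro ⟨f, rfl⟩
    exact ⟨SignData.labelled_perm _, SignData.dev_one (SignData.mk f.1 f.2.1 f.2.2)⟩
  · rintro ⟨hl, h1⟩
    refine ⟨⟨sgn g.toPerm, hl.sgn_zpow_self, fun _ _ h => hl.sgn_zpow_linked h⟩, ?_⟩
    refine Aut.toPerm_injective ?_
    refine Labelled.ext_of_sgn (SignData.labelled_perm _) hl (u := 1) ?_ fun s v => ?_
    · rw [h1]; exact SignData.dev_one hl.signData
    · exact SignData.sgn_perm _ _ _

theorem isCompact_baseStabilizer : IsCompact (baseStabilizer : Set Aut) := by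
  rw [← range_ofSigns]
  have : CompactSpace signSet := isCompact_iff_compactSpace.1 isCompact_signSet
  exact isCompact_range continuous_ofSigns

instance : LocallyCompactSpace Aut :=
  isCompact_baseStabilizer.locallyCompactSpace_of_mem_nhds_of_group
    (isOpen_baseStabilizer.mem_nhds (one_mem _))

theorem locallyCompactSpace_autPlus : LocallyCompactSpace AutPlus :=
  isClosed_autPlus.isClosedEmbedding_subtypeVal.locallyCompactSpace

/-! ### Non-discreteness and non-compactness of the quotient. -/

/-- The reflections of the line of label `d` through `a ^ n`, normalized to fix the base vertex. -/
def flipAt (n : ℕ) : Aut := (flipData .d (gen .a ^ (n : ℤ))).labelled_perm.toAut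

theorem flipAt_injective : Function.Injective flipAt := by
  intro m n h
  have h1 : sgn (flipAt m).toPerm .d (gen .a ^ (m : ℤ)) = -1 :=
    (SignData.sgn_perm _ _ _).trans (by simp [flipData, one_mem])
  rw [h] at h1
  have h2 := (SignData.sgn_perm (flipData .d (gen .a ^ (n : ℤ))) .d _).symm.trans h1
  by_contra hne
  have h3 : (gen .a ^ (n : ℤ))⁻¹ * gen .a ^ (m : ℤ) ∉ starSubgroup .d := by
    intro hm
    have := expo_of_mem_star (t := .a) (by simp) (by rintro ⟨⟩) hm
    rw [← zpow_neg, ← zpow_add, expo_zpow_self, ← ofAdd_zero] at this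
    have := Multiplicative.ofAdd.injective this
    omega
  simp only [flipData, h3, and_false, if_false] at h2
  exact absurd h2 (by decide)

theorem flipAt_mem (n : ℕ) : flipAt n ∈ baseStabilizer :=
  ⟨SignData.labelled_perm _, SignData.dev_one (flipData .d (gen .a ^ (n : ℤ)))⟩

/-- In a discrete group the compact base stabilizer would be finite, but it contains all `flipAt n`.
-/
theorem not_discreteTopology_autPlus : ¬ DiscreteTopology AutPlus := by
  intro hd
  have h1 : IsCompact ((Subtype.val : AutPlus → Aut) ⁻¹' baseStabilizer) :=
    isClosed_autPlus.isClosedEmbedding_subtypeVal.isCompact_preimage isCompact_baseStabilizer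
  have h2 := h1.finite DiscreteTopology.isDiscrete
  refine Set.infinite_of_injective_forall_mem (f := fun n : ℕ =>
    (⟨flipAt n, baseStabilizer_le (flipAt_mem n)⟩ : AutPlus)) ?_ (fun n => flipAt_mem n) h2
  exact fun m n h => flipAt_injective (congrArg Subtype.val h)

/-- The homomorphism to the infinite dihedral group that sends `a` and `d` to reflections and kills
`b` and `c`. -/
def toDihedral : Grp →* DihedralGroup 0 :=
  lift (fun s => match s with
    | .a => .sr 0
    | .d => .sr 1
    | _ => 1) (by rintro _ _ ⟨⟩ <;> simp)

/-- Generators go to involutions or to `1`, so signs become invisible. -/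
theorem toDihedral_zpow (s : Gen) (η : ℤˣ) :
    toDihedral (gen s ^ (η : ℤ)) = toDihedral (gen s) := by
  rcases units_cases η with rfl | rfl
  · simp
  · cases s <;> simp [toDihedral]

theorem toDihedral_eq_of_fixes {g : Aut} (hl : Labelled g.toPerm) {u : Grp} (hu : g.toPerm u = u)
    (v : Grp) : toDihedral (g.toPerm v) = toDihedral v := by
  induction v using vertex_induction u with
  | h1 => rw [hu]
  | hs v s η ih =>
    have := hl.map_zpow v s η
    rw [this, ← Units.val_mul, map_mul, map_mul, toDihedral_zpow, toDihedral_zpow, ih]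

theorem toDihedral_autPlus {g : Aut} (hg : g ∈ AutPlus) (v : Grp) :
    toDihedral (g.toPerm v) = toDihedral v := by
  induction hg using Subgroup.closure_induction generalizing v with
  | mem g hg =>
    obtain ⟨h, hh, hg⟩ := hg
    obtain ⟨hl, u, hu⟩ := labelled_of_fixes_halfspace hh hg
    exact toDihedral_eq_of_fixes hl hu v
  | one => rfl
  | mul g h _ _ ig ih => rw [Aut.toPerm_mul, Equiv.Perm.mul_apply, ig, ih]
  | inv g _ ig =>
    have := ig (g⁻¹.toPerm v)
    rw [Aut.toPerm_inv] at this ⊢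
    rw [← this]; simp

/-- The quotient by an open subgroup is discrete, so compactness would make it finite. The
translations by powers of `d * a` represent distinct cosets, since `d * a` goes to a rotation of
infinite order. -/
theorem not_compactSpace_quotient : ¬ CompactSpace (Aut ⧸ AutPlus.topologicalClosure) := by
  intro hc
  have hcl : AutPlus.topologicalClosure = AutPlus :=
    le_antisymm (Subgroup.topologicalClosure_minimal _ le_rfl isClosed_autPlus)
      (Subgroup.le_topologicalClosure _)
  rw [hcl] at hc
  have hd : DiscreteTopology (Aut ⧸ AutPlus) := QuotientGroup.discreteTopology isOpen_autPlus
  have hfin : Finite (Aut ⧸ AutPlus) := finite_of_compact_of_discrete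
  let τ : ℕ → Aut := fun n => (labelled_mulLeft ((gen .d * gen .a) ^ n)).toAut
  refine not_injective_infinite_finite (fun n => (QuotientGroup.mk (τ n) : Aut ⧸ AutPlus)) ?_
  intro m n h
  have h1 := toDihedral_autPlus (QuotientGroup.eq.1 h) 1
  have h2 : ∀ n : ℕ, toDihedral ((gen .d * gen .a) ^ n) = .r (-(n : ℤ)) := by
    intro n
    have : toDihedral (gen .d * gen .a) = .r (-1) := by simp [toDihedral]
    rw [map_pow, this, DihedralGroup.r_pow]
    congr 1
    change (-1 : ℤ) * n = - n
    ring
  have h3 : ((τ m)⁻¹ * τ n).toPerm 1 = ((gen .d * gen .a) ^ m)⁻¹ * (gen .d * gen .a) ^ n := by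
    rw [Aut.toPerm_mul, Aut.toPerm_inv, Equiv.Perm.mul_apply, Equiv.Perm.inv_eq_iff_eq]
    simp [τ, Equiv.coe_mulLeft]
  rw [h3, map_mul, map_inv, map_one, h2, h2, inv_mul_eq_one] at h1
  have h4 := DihedralGroup.r.inj h1
  have h5 : -(m : ℤ) = -(n : ℤ) := h4
  omega

/-! ### Displacing a side of a wall. -/

/-- The subgroup generated by the generators other than `a`. -/
def noA : Subgroup Grp := Subgroup.closure (gen '' {s | s ≠ Gen.a})

theorem gen_zpow_mem_noA {s : Gen} (h : s ≠ .a) (k : ℤ) : gen s ^ k ∈ noA :=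
  Subgroup.zpow_mem _ (Subgroup.subset_closure (Set.mem_image_of_mem gen h)) k

theorem bLine_le_noA : bLine ≤ noA := by
  rintro _ ⟨k, rfl⟩
  exact gen_zpow_mem_noA (by simp) k

theorem IsHS.mem_iff_noA {S : Set Grp} {u : Grp} {ε : ℤˣ} (h : IsHS S u ε) (v : Grp) {x : Grp}
    (hx : x ∈ noA) : v * x ∈ S ↔ v ∈ S := by
  induction hx using Subgroup.closure_induction generalizing v with
  | mem x hx =>
    obtain ⟨s, hs, rfl⟩ := hx
    simpa using h.mem_iff_of_ne v hs 1
  | one => simp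
  | mul x y _ _ ihx ihy => rw [← mul_assoc, ihy, ihx]
  | inv x _ ih => rw [← ih, inv_mul_cancel_right]

/-- The homomorphism to the infinite dihedral group that sends `b` to a rotation, `d` to a
reflection, and kills `a` and `c`. -/
def toDihedral' : Grp →* DihedralGroup 0 :=
  lift (fun s => match s with
    | .b => .r 1
    | .d => .sr 0
    | _ => 1) (by rintro _ _ ⟨⟩ <;> simp)

/-- The exponent sum of `b` shows that the conjugate is the same power of `b`, while in the dihedral
group `d` inverts the rotation `b`; so the exponent equals its negative. -/
theorem eq_one_of_conj_mem_bLine {x : Grp} {δ : ℤˣ} (hx : x ∈ bLine)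
    (h : (gen .d)⁻¹ * (x * gen .d ^ (δ : ℤ)) ∈ bLine) : x = 1 := by
  obtain ⟨k, rfl⟩ := hx
  obtain ⟨l, hl⟩ := h
  simp only at hl
  have h1 := congrArg (expo .b) hl
  rw [map_mul, map_mul, map_inv, expo_zpow_self, expo_zpow_self, expo_gen_of_ne (by simp),
    expo_zpow_of_ne (by simp), inv_one, one_mul, mul_one] at h1
  have hlk : l = k := Multiplicative.ofAdd.injective h1
  subst hlk
  have h2 := congrArg toDihedral' hl
  have hb : toDihedral' (gen .b) = .r 1 := by simp [toDihedral']
  have hd : toDihedral' (gen .d) = .sr 0 := by simp [toDihedral']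
  have hdδ : toDihedral' (gen .d ^ (δ : ℤ)) = .sr 0 := by
    rcases units_cases δ with rfl | rfl
    · simp [hd]
    · simp [hd]
  rw [map_mul, map_mul, map_inv, hdδ, hd, map_zpow, hb, DihedralGroup.r_zpow] at h2
  simp only [DihedralGroup.inv_sr, DihedralGroup.r_mul_sr, DihedralGroup.sr_mul_sr] at h2
  have h3 := DihedralGroup.r.inj h2
  have h4 : (1 : ℤ) * l = 0 - 1 * l - 0 := h3
  have : l = 0 := by omega
  simp [this]

/-- A nontrivial labelled permutation moves some coset of `noA`. -/
theorem exists_notMem_noA {σ : Equiv.Perm Grp} (hσ : Labelled σ) (hne : σ ≠ 1) :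
    ∃ v, v⁻¹ * σ v ∉ noA := by
  by_contra! H
  -- If all cosets of `noA` are preserved, `v` and `v * gen .a` stay on their sides of the wall
  -- between them; the image edge crosses this wall, so it starts on the `b`-line of `v`.
  have step : ∀ v, v⁻¹ * σ v ∈ bLine := by
    intro v
    have hS := isHS_HS v 1
    have h1 : σ v ∉ HS v 1 := by
      have := hS.mem_iff_noA v (H v)
      rw [mul_inv_cancel_left] at this
      exact mt this.1 hS.notMem
    have h2 : σ (v * gen .a) ∈ HS v 1 := by
      have := hS.mem_iff_noA (v * gen .a) (H (v * gen .a))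
      rw [mul_inv_cancel_left] at this
      exact this.2 (by simpa using hS.mem)
    have h3 := hσ.map_zpow v .a 1
    rw [zpow_one, mul_one] at h3
    rw [h3] at h2
    exact ((hS _ _ _).1 ⟨h1, h2⟩).2.2
  refine hne (Equiv.ext fun v => ?_)
  have h1 := hσ.map_zpow v .d 1
  have h2 := step (v * gen .d)
  rw [zpow_one, mul_one] at h1
  rw [h1] at h2
  have h3 := eq_one_of_conj_mem_bLine (step v) (δ := sgn σ .d v) (by simpa [mul_assoc] using h2)
  exact (inv_mul_eq_one.1 h3).symm

theorem disjoint_image {σ : Equiv.Perm Grp} (hσ : Labelled σ) {p : Grp} {ε : ℤˣ}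
    (hb : p⁻¹ * σ p ∉ bLine) (h1 : σ p ∉ HS p ε) (h2 : σ⁻¹ p ∉ HS p ε) :
    Disjoint (HS p ε) (σ '' HS p ε) := by
  refine (isHS_HS p ε).disjoint ((isHS_HS p ε).image hσ) ?_ h1 fun h => hb h.1
  rintro ⟨w, hw, hwp⟩
  have hw' : σ⁻¹ p = w := Equiv.Perm.inv_eq_iff_eq.2 hwp.symm
  exact h2 (hw' ▸ hw)

theorem d_mem_noA : gen .d ∈ noA := by simpa using gen_zpow_mem_noA (s := .d) (by simp) 1

theorem d_notMem_bLine : gen .d ∉ bLine := by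
  rintro ⟨k, hk⟩
  have := congrArg (expo .d) hk
  simp only [expo_zpow_of_ne (show Gen.b ≠ .d by simp), expo_gen_self] at this
  rw [← ofAdd_zero] at this
  exact one_ne_zero (Multiplicative.ofAdd.injective this).symm

theorem notMem_HS_d (v : Grp) (ε : ℤˣ) : v ∉ HS (v * gen .d) ε :=
  mt ((isHS_HS (v * gen .d) ε).mem_iff_noA v d_mem_noA).2 (isHS_HS _ _).notMem

theorem disjoint_HS_d (v : Grp) (ε δ : ℤˣ) : Disjoint (HS v ε) (HS (v * gen .d) δ) := by
  refine (isHS_HS v ε).disjoint (isHS_HS _ δ) (notMem_HS_d v δ) ?_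
    fun h => d_notMem_bLine (by simpa using h.1)
  exact mt ((isHS_HS v ε).mem_iff_noA v d_mem_noA).1 (isHS_HS v ε).notMem

/-- A nontrivial labelled permutation carries some side of a wall to a disjoint set. -/
theorem exists_disjoint_image {σ : Equiv.Perm Grp} (hσ : Labelled σ) (hne : σ ≠ 1) :
    ∃ p ε, Disjoint (HS p ε) (σ '' HS p ε) := by
  obtain ⟨v, hv⟩ := exists_notMem_noA hσ hne
  have hmapd : ∀ {τ : Equiv.Perm Grp}, Labelled τ → ∃ x ∈ noA, τ (v * gen .d) = τ v * x := by
    intro τ hτ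
    have := hτ.map_zpow v .d 1
    rw [zpow_one] at this
    exact ⟨_, gen_zpow_mem_noA (by simp) _, this⟩
  obtain ⟨x, hx, hxe⟩ := hmapd hσ
  obtain ⟨y, hy, hye⟩ := hmapd hσ.inv
  have c1 : ∀ ε, σ v ∉ HS v ε → σ⁻¹ v ∉ HS v ε → Disjoint (HS v ε) (σ '' HS v ε) :=
    fun ε h1 h2 => disjoint_image hσ (fun h => hv (bLine_le_noA h)) h1 h2
  have c2 : σ v ∉ HS (v * gen .d) 1 → σ⁻¹ v ∉ HS (v * gen .d) 1 →
      Disjoint (HS (v * gen .d) 1) (σ '' HS (v * gen .d) 1) := by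
    intro h1 h2
    refine disjoint_image hσ (fun h => hv ?_) ?_ ?_
    · rw [hxe] at h
      have := mul_mem (mul_mem d_mem_noA (bLine_le_noA h)) (inv_mem hx)
      simpa [mul_assoc] using this
    · rw [hxe, (isHS_HS _ _).mem_iff_noA _ hx]; exact h1
    · rw [hye, (isHS_HS _ _).mem_iff_noA _ hy]; exact h2
  -- Three pairwise disjoint sides and only two points `σ v`, `σ⁻¹ v`: some side contains neither.
  have e1 := Set.disjoint_left.1 (disjoint_HS_neg v 1)
  have e2 := Set.disjoint_left.1 (disjoint_HS_d v 1 1)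
  have e3 := Set.disjoint_left.1 (disjoint_HS_d v (-1) 1)
  by_contra! hcon
  have n1 := fun a b => hcon _ _ (c1 1 a b)
  have n2 := fun a b => hcon _ _ (c1 (-1) a b)
  have n3 := fun a b => hcon _ _ (c2 a b)
  have := @e1 (σ v)
  have := @e2 (σ v)
  have := @e3 (σ v)
  have := @e1 (σ⁻¹ v)
  have := @e2 (σ⁻¹ v)
  have := @e3 (σ⁻¹ v)
  clear c1 c2 hcon e1 e2 e3
  tauto

/-! ### Commutators and simplicity. -/

theorem rist_mem_iff {S : Set Grp} {f : Aut} (hf : f ∈ rist S) (v : Grp) :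
    f.toPerm v ∈ S ↔ v ∈ S := by
  constructor
  · intro h
    by_contra hv
    rw [hf.2 v hv] at h
    exact hv h
  · intro h
    by_contra hv
    have := f.toPerm.injective (hf.2 _ hv)
    exact hv (this.symm ▸ h)

theorem conj_mem_rist {S : Set Grp} {f g : Aut} (hf : f ∈ rist S) (hg : Labelled g.toPerm) :
    g * f * g⁻¹ ∈ rist (g.toPerm '' S) := by
  refine ⟨(hg.mul hf.1).mul hg.inv, fun v hv => ?_⟩
  have h : (g.toPerm)⁻¹ v ∉ S := fun h => hv ⟨_, h, by simp⟩
  rw [Aut.toPerm_mul, Aut.toPerm_mul, Aut.toPerm_inv, Equiv.Perm.mul_apply, Equiv.Perm.mul_apply,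
    hf.2 _ h]
  simp

theorem labelled_pow {σ : Equiv.Perm Grp} (hσ : Labelled σ) (j : ℕ) : Labelled (σ ^ j) := by
  induction j with
  | zero => exact Labelled.one
  | succ j ih => rw [pow_succ]; exact ih.mul hσ

/-- If the translates of a side of a wall by the powers of `m` are disjoint, then every
automorphism supported in it is a commutator of `m` and an element of `Aut⁺(X)`. -/
theorem exists_commutator {m f : Aut} (hm : Labelled m.toPerm) {u : Grp} {ε : ℤˣ}
    (hd : Pairwise fun i j : ℕ =>
      Disjoint ((m.toPerm ^ i) '' HS u ε) ((m.toPerm ^ j) '' HS u ε))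
    (hf : f ∈ rist (HS u ε)) : ∃ F ∈ AutPlus, f = F * m * F⁻¹ * m⁻¹ := by
  set σ := m.toPerm with hσ
  let S : ℕ → Set Grp := fun j => (σ ^ j) '' HS u ε
  let φ : ℕ → Equiv.Perm Grp := fun j => σ ^ j * f.toPerm * (σ ^ j)⁻¹
  have hφ : ∀ j, (labelled_pow hm j).toAut * f * (labelled_pow hm j).toAut⁻¹ ∈ rist (S j) :=
    fun j => conj_mem_rist hf (labelled_pow hm j)
  have hφS : ∀ j v, φ j v ∈ S j ↔ v ∈ S j := fun j v => rist_mem_iff (hφ j) v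
  have h1 : ∀ j v, v ∈ S j → φ j v ∈ S j := fun j v h => (hφS j v).2 h
  have h2 : ∀ j v, v ∈ S j → (φ j)⁻¹ v ∈ S j := fun j v h => (hφS j _).1 (by simpa using h)
  have hL := labelled_glue (f := φ) hd h1 h2 (fun j => (hφ j).1) (by
    intro j v s η _ hw
    obtain ⟨hl, hfix⟩ := hφ j
    simp only [S, image_HS (labelled_pow hm j)] at hw hfix
    exact fixes_boundary hl hfix hw)
  have hF : ∀ j v, v ∈ S j → hL.toAut.toPerm v = φ j v := fun j v hv =>
    glueFun_of_mem (f := φ) hd hv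
  have hF' : ∀ v, (∀ j, v ∉ S j) → hL.toAut.toPerm v = v := fun v hv =>
    glueFun_of_notMem (f := φ) hv
  have hS0 : S 0 = HS u ε := by simp [S]
  have hφ0 : φ 0 = f.toPerm := by simp [φ]
  have hSs : ∀ j v, σ v ∈ S (j + 1) ↔ v ∈ S j := fun j v => by
    simp only [S, pow_succ', Equiv.Perm.coe_mul, Set.image_comp, σ.injective.mem_set_image]
  have hφs : ∀ j v, φ (j + 1) (σ v) = σ (φ j v) := fun j v => by
    simp [φ, pow_succ', mul_inv_rev]
  refine ⟨hL.toAut, mem_autPlus (u := u * gen .a ^ (ε : ℤ)) hL ?_, ?_⟩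
  · rw [hF 0 _ (hS0 ▸ (isHS_HS u ε).mem), hφ0]
    refine fixes_boundary hf.1 hf.2 (s := .a) (η := -ε) ?_
    simpa using (isHS_HS u ε).notMem
  -- Conjugation by `m` shifts the factors of the infinite product by one index, so the commutator
  -- telescopes to the factor of index `0`, which is `f`.
  · rw [eq_mul_inv_iff_mul_eq, eq_mul_inv_iff_mul_eq]
    ext v
    simp only [Aut.toPerm_mul, Equiv.Perm.mul_apply, ← hσ]
    by_cases hv : ∃ j, v ∈ S j
    · obtain ⟨j, hj⟩ := hv
      rw [hF j v hj, hF (j + 1) _ ((hSs j v).2 hj), hφs]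
      refine hf.2 _ fun h => ?_
      have h0 : Disjoint (S (j + 1)) (S 0) := hd (Nat.succ_ne_zero j)
      exact Set.disjoint_left.1 h0 ((hSs j _).2 (h1 j v hj)) (hS0.symm ▸ h)
    · push Not at hv
      rw [hF' v hv]
      by_cases h0 : σ v ∈ S 0
      · rw [hF 0 _ h0, hφ0]
      · rw [hf.2 _ (hS0 ▸ h0), hF' _ fun j => ?_]
        cases j with
        | zero => exact h0
        | succ j => exact mt (hSs j v).1 (hv j)

theorem flip_mem_autPlus (s : Gen) (u : Grp) : (labelled_flip s u).toAut ∈ AutPlus :=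
  mem_autPlus (labelled_flip s u) (flip_self s u)

theorem image_flip (u : Grp) (ε : ℤˣ) : flip .a u '' HS u ε = HS u (-ε) := by
  rw [image_HS (labelled_flip _ _), flip_self, sgn_flip_self, neg_one_mul]

/-- The side of the next wall along a line of label `a` is contained in the side of the first. -/
theorem HS_next_subset (u : Grp) (ε : ℤˣ) : HS (u * gen .a ^ (ε : ℤ)) ε ⊆ HS u ε := by
  have := disjoint_HS_neg (u * gen .a ^ (ε : ℤ)) ε
  rw [← compl_HS] at this
  exact Set.disjoint_compl_right_iff_subset.1 this

theorem image_flip_compl (u : Grp) (ε : ℤˣ) :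
    flip .a (u * gen .a ^ (ε : ℤ)) '' (HS u ε)ᶜ = HS (u * gen .a ^ (ε : ℤ)) ε := by
  rw [compl_HS, image_flip, neg_neg]

/-- The two sides based at `u'` are disjoint, so one of them omits `u`; that one is disjoint from
`S` unless `u` and `u'` are on the same `b`-line, in which case `S` itself is a side at `u'`. -/
theorem exists_sign_subset {S : Set Grp} {u : Grp} {ε : ℤˣ} (h : IsHS S u ε) {u' : Grp}
    (hu' : u' ∉ S) : ∃ η, HS u' η ⊆ S ∨ HS u' η ⊆ Sᶜ := by
  by_cases hs : u⁻¹ * u' ∈ bLine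
  · exact ⟨ε, .inl (h.eq (isHS_HS u' ε) hs).ge⟩
  · have key : ∃ η, u ∉ HS u' η := by
      by_contra! hcon
      exact Set.disjoint_left.1 (disjoint_HS_neg u' 1) (hcon _) (hcon _)
    obtain ⟨η, hη⟩ := key
    exact ⟨η, .inr (h.disjoint (isHS_HS u' η) hη hu' fun h => hs h.1).symm.subset_compl_right⟩

/-- Every side of a wall is carried into any other one by an element of `Aut⁺(X)`. -/
theorem exists_image_subset (u u' : Grp) (ε ε' : ℤˣ) :
    ∃ g ∈ AutPlus, g.toPerm '' HS u' ε' ⊆ HS u ε := by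
  have h1 : ∃ η, HS u' η ⊆ HS u ε ∨ HS u' η ⊆ (HS u ε)ᶜ := by
    by_cases hu' : u' ∈ HS u ε
    · obtain ⟨η, h⟩ := exists_sign_subset (isHS_HS u ε).compl (u' := u') (by simpa using hu')
      exact ⟨η, by rwa [compl_compl, or_comm] at h⟩
    · exact exists_sign_subset (isHS_HS u ε) hu'
  obtain ⟨η, hη⟩ := h1
  have h2 : ∃ g ∈ AutPlus, g.toPerm '' HS u' ε' = HS u' η := by
    by_cases h : ε' = η
    · exact ⟨1, one_mem _, by simp [h]⟩
    · refine ⟨_, flip_mem_autPlus .a u', ?_⟩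
      rw [Labelled.toPerm_toAut, image_flip]
      rcases units_cases ε' with rfl | rfl <;> rcases units_cases η with rfl | rfl <;> simp_all
  obtain ⟨g, hg, hge⟩ := h2
  rcases hη with hη | hη
  · exact ⟨g, hg, hge ▸ hη⟩
  · refine ⟨_, mul_mem (flip_mem_autPlus .a (u * gen .a ^ (ε : ℤ))) hg, ?_⟩
    rw [Aut.toPerm_mul, Equiv.Perm.coe_mul, Set.image_comp, hge, Labelled.toPerm_toAut]
    refine (Set.image_mono hη).trans ?_
    rw [image_flip_compl]
    exact HS_next_subset u ε

/-- If `m` carries `h` into itself, the translates of a set in `h` outside `m h` are disjoint. -/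
theorem pairwise_disjoint_translates {α : Type*} {σ : Equiv.Perm α} {h k : Set α}
    (hh : σ '' h ⊆ h) (hk : k ⊆ h) (hd : Disjoint k (σ '' h)) :
    Pairwise fun i j : ℕ => Disjoint ((σ ^ i) '' k) ((σ ^ j) '' k) := by
  have hpow : ∀ n : ℕ, (σ ^ n) '' h ⊆ h := by
    intro n
    induction n with
    | zero => simp
    | succ n ih =>
      rw [pow_succ, Equiv.Perm.coe_mul, Set.image_comp]
      exact (Set.image_mono hh).trans ih
  have key : ∀ i n : ℕ, Disjoint ((σ ^ i) '' k) ((σ ^ (i + (n + 1))) '' k) := by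
    intro i n
    rw [pow_add, Equiv.Perm.coe_mul, Set.image_comp,
      Set.disjoint_image_iff (Equiv.injective _)]
    refine hd.mono_right ?_
    rw [pow_succ', Equiv.Perm.coe_mul, Set.image_comp]
    exact Set.image_mono ((Set.image_mono hk).trans (hpow n))
  intro i j hij
  rcases lt_or_gt_of_ne hij with h | h
  · obtain ⟨n, rfl⟩ := Nat.exists_eq_add_of_lt h
    exact key i n
  · obtain ⟨n, rfl⟩ := Nat.exists_eq_add_of_lt h
    exact (key j n).symm

/-- A nontrivial subgroup of `Aut⁺(X)` that is normalized by `Aut⁺(X)` is all of `Aut⁺(X)`. -/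
theorem autPlus_le_of_normalized {M : Subgroup Aut} (hM : M ≤ AutPlus)
    (hc : ∀ g ∈ AutPlus, ∀ n ∈ M, g * n * g⁻¹ ∈ M) {n : Aut} (hn : n ∈ M) (hne : n ≠ 1) :
    AutPlus ≤ M := by
  have hnl := labelled_of_mem_autPlus (hM hn)
  obtain ⟨u, ε, hd⟩ := exists_disjoint_image hnl fun h => hne (Aut.toPerm_injective h)
  set w := u * gen .a ^ (ε : ℤ) with hw
  set r := (labelled_flip .a w).toAut with hr
  have hrP : r ∈ AutPlus := flip_mem_autPlus .a w
  have hrc : r.toPerm '' (HS u ε)ᶜ = HS w ε := image_flip_compl u ε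
  have hsub : HS w ε ⊆ HS u ε := HS_next_subset u ε
  -- Here `n` pushes the side into its complement, `r⁻¹` brings that back inside, `n` pushes it out
  -- again, and `r` sends it into the smaller side `HS w ε`.
  set m := r * n * r⁻¹ * n with hm
  have hmM : m ∈ M := mul_mem (hc r hrP n hn) hn
  have hnc : n.toPerm '' HS u ε ⊆ (HS u ε)ᶜ := hd.symm.subset_compl_right
  have hmh : m.toPerm '' HS u ε ⊆ HS w ε := by
    have e1 : (r⁻¹).toPerm '' (HS u ε)ᶜ ⊆ HS u ε := by
      rintro _ ⟨v, hv, rfl⟩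
      by_contra hcon
      have h1 : r.toPerm ((r⁻¹).toPerm v) ∈ HS w ε := hrc ▸ Set.mem_image_of_mem _ hcon
      rw [Aut.toPerm_inv] at h1
      exact hv (hsub (by simpa using h1))
    rintro _ ⟨v, hv, rfl⟩
    have h1 := e1 (Set.mem_image_of_mem _ (hnc (Set.mem_image_of_mem _ hv)))
    exact hrc ▸ Set.mem_image_of_mem _ (hnc (Set.mem_image_of_mem _ h1))
  -- The side at `w * gen .d` fits into the gap between `HS u ε` and `HS w ε`, so its translates by
  -- the powers of `m` are disjoint.
  have hk1 : Disjoint (HS (w * gen .d) ε) (HS w ε) := (disjoint_HS_d w ε ε).symm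
  have hk2 : HS (w * gen .d) ε ⊆ HS u ε := by
    have := disjoint_HS_d w (-ε) ε
    rw [hw, ← compl_HS, ← hw] at this
    exact Set.disjoint_compl_left_iff_subset.1 this
  have hpd := pairwise_disjoint_translates (hmh.trans hsub) hk2 (hk1.mono_right hmh)
  have hk : rist (HS (w * gen .d) ε) ⊆ M := by
    intro f hf
    obtain ⟨F, hF, rfl⟩ := exists_commutator (labelled_of_mem_autPlus (hM hmM)) hpd hf
    exact mul_mem (hc F hF m hmM) (inv_mem hmM)
  rw [autPlus_eq]
  refine (Subgroup.closure_le _).2 (Set.iUnion_subset fun u' => Set.iUnion_subset fun ε' => ?_)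
  intro f hf
  obtain ⟨g, hg, hgs⟩ := exists_image_subset (w * gen .d) u' ε ε'
  have h1 := conj_mem_rist hf (labelled_of_mem_autPlus hg)
  have h2 : g * f * g⁻¹ ∈ M := hk ⟨h1.1, fun v hv => h1.2 v fun h => hv (hgs h)⟩
  have h3 := hc g⁻¹ (inv_mem hg) _ h2
  simpa [mul_assoc] using h3

theorem isSimpleGroup_autPlus : IsSimpleGroup AutPlus where
  exists_pair_ne := ⟨⟨flipAt 0, baseStabilizer_le (flipAt_mem 0)⟩,
    ⟨flipAt 1, baseStabilizer_le (flipAt_mem 1)⟩,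
    fun h => zero_ne_one (flipAt_injective (congrArg Subtype.val h))⟩
  eq_bot_or_eq_top_of_normal N hN := by
    rw [or_iff_not_imp_left]
    intro hbot
    obtain ⟨⟨n, hn⟩, hne'⟩ := Subgroup.ne_bot_iff_exists_ne_one.1 hbot
    have hne : n ≠ 1 := fun e => hne' (Subtype.ext e)
    have h := autPlus_le_of_normalized (M := N.map AutPlus.subtype)
      (Subgroup.map_subtype_le N) (by
        rintro g hg _ ⟨x, hx, rfl⟩
        exact ⟨⟨g, hg⟩ * x * ⟨g, hg⟩⁻¹, hN.conj_mem x hx ⟨g, hg⟩, rfl⟩)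
      (Subgroup.mem_map_of_mem _ hn) (fun e => hne (Subtype.ext e))
    rw [eq_top_iff]
    intro g _
    obtain ⟨x, hx, hxg⟩ := h g.2
    exact Subtype.ext hxg ▸ hx

end CrokeKleiner


end

theorem mainTheorem10 :
    ∃ _ : IsTopologicalGroup CrokeKleiner.Aut,
      ¬ CompactSpace (CrokeKleiner.Aut ⧸ CrokeKleiner.AutPlus.topologicalClosure) ∧
      IsSimpleGroup CrokeKleiner.AutPlus ∧
      ¬ DiscreteTopology CrokeKleiner.AutPlus ∧
      TotallyDisconnectedSpace CrokeKleiner.AutPlus ∧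
      LocallyCompactSpace CrokeKleiner.AutPlus :=
  ⟨inferInstance, CrokeKleiner.not_compactSpace_quotient, CrokeKleiner.isSimpleGroup_autPlus,
    CrokeKleiner.not_discreteTopology_autPlus, inferInstance,
    CrokeKleiner.locallyCompactSpace_autPlus⟩
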